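/- Let $m\ge 2$ and $q\ge 2$ be integers. On the space $\Sigma_m$ of sequences $(x_k)_{k=1}^\infty$ with $x_k\in\{0,\dots,m-1\}$ use the metric $\varrho(x,y)=m^{-\min\{n:\,x_n\ne y_n\}+1}$ for $x\neq y$ (and $\varrho(x,x)=0$). Let $A=(A(i,j))_{i,j=0}^{m-1}$ be a primitive matrix with entries in $\{0,1\}$ (primitive: some power $A^p$, $p\ge1$, has all entries strictly positive), and let $$X_A=\{(x_k)_{k\ge1}\in\Sigma_m:\ A(x_k,x_{qk})=1\text{ for all }k\ge 1\}.$$ Write $\log_m$ for the logarithm to base $m$, $\overline 1=(1,\dots,1)^T\in\mathbb R^m$, and $(\cdot,\cdot)$ for the standard inner product on $\mathbb R^m$. The Minkowski dimension $\dim_M(S)$ of a set $S$ is the limit of $\log N_r(S)/\log(1/r)$ as $r\to0^+$, if it exists, where $N_r(S)$ is the least number of balls of radius $r$ needed to cover $S$. (i) There is exactly one vector $(t_i)_{i=0}^{m-1}$ of real numbers with $t_i>1$ and $t_i^q=\sum_{j=0}^{m-1}A(i,j)\,t_j$ for all $i=0,\dots,m-1$, and with this vector the Hausdorff dimension of $X_A$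 is $$\dim_H(X_A)=\frac{q-1}{q}\,\log_m\sum_{i=0}^{m-1}t_i .$$ (ii) The Minkowski dimension of $X_A$ exists and equals $$\dim_M(X_A)=(q-1)^2\sum_{k=1}^\infty\frac{\log_m\,(A^{k-1}\overline 1,\overline 1)}{q^{k+1}},$$ where the series converges. Moreover, $\dim_H(X_A)=\dim_M(X_A)$ if and only if $\overline 1$ is an eigenvector of $A$, that is, if and only if all row sums of $A$ are equal. -/

import Mathlib

open Filter Topology
open scoped Matrix NNReal ENNReal

/-- The space of sequences `x_1 x_2 x_3 …` (indexed by the positive integers) over the alphabet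
`{0, …, m - 1}`. It is a structure, so that it carries only the metric defined below and
not the product structure of `ℕ+ → Fin m`. -/
@[ext]
structure SeqSpace (m : ℕ) where
  /-- `x.digit n` is the term `x_n`. -/
  digit : ℕ+ → Fin m

namespace SeqSpace

open Classical in
/-- The distance `ϱ(x, y) = m ^ (-min {n : x_n ≠ y_n} + 1)` for `x ≠ y`, and `ϱ(x, x) = 0`. -/
noncomputable def rho {m : ℕ} (x y : SeqSpace m) : ℝ :=
  if h : ∃ n : ℕ+, x.digit n ≠ y.digit n then (m : ℝ) ^ (-((PNat.find h : ℕ) : ℤ) + 1) else 0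

lemma rho_self {m : ℕ} (x : SeqSpace m) : rho x x = 0 := by
  simp [rho]

lemma rho_nonneg {m : ℕ} (x y : SeqSpace m) : 0 ≤ rho x y := by
  unfold rho
  split_ifs
  · positivity
  · exact le_rfl

lemma rho_comm {m : ℕ} (x y : SeqSpace m) : rho x y = rho y x := by
  classical
  by_cases h : ∃ n : ℕ+, x.digit n ≠ y.digit n
  · have h' : ∃ n : ℕ+, y.digit n ≠ x.digit n := h.imp fun _ => Ne.symm
    have hfind : PNat.find h = PNat.find h' :=
      le_antisymm (PNat.find_min' h (PNat.find_spec h').symm)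
        (PNat.find_min' h' (PNat.find_spec h).symm)
    have hcalc : (m : ℝ) ^ (-((PNat.find h : ℕ) : ℤ) + 1)
        = (m : ℝ) ^ (-((PNat.find h' : ℕ) : ℤ) + 1) := by rw [hfind]
    unfold rho
    rw [dif_pos h, dif_pos h']
    convert hcalc
  · have h' : ¬ ∃ n : ℕ+, y.digit n ≠ x.digit n := fun h' => h (h'.imp fun _ => Ne.symm)
    rw [rho, rho, dif_neg h, dif_neg h']

lemma eq_of_rho_eq_zero {m : ℕ} {x y : SeqSpace m} (h : rho x y = 0) : x = y := by
  by_contra hne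
  have hex : ∃ n : ℕ+, x.digit n ≠ y.digit n := Function.ne_iff.mp fun h' => hne (SeqSpace.ext h')
  have hm : (0 : ℝ) < m := by exact_mod_cast Fin.pos (x.digit 1)
  rw [rho, dif_pos hex] at h
  exact (zpow_pos hm _).ne' h

lemma rho_triangle_max {m : ℕ} (x y z : SeqSpace m) : rho x z ≤ max (rho x y) (rho y z) := by
  classical
  have hm : (1 : ℝ) ≤ m := by exact_mod_cast Fin.pos (x.digit 1)
  by_cases hxz : ∃ n : ℕ+, x.digit n ≠ z.digit n
  swap
  · rw [rho, dif_neg hxz]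
    exact le_max_of_le_left (rho_nonneg x y)
  have key : ∀ {u v : SeqSpace m}, u.digit (PNat.find hxz) ≠ v.digit (PNat.find hxz) →
      rho x z ≤ rho u v := by
    intro u v huv
    have hex : ∃ n : ℕ+, u.digit n ≠ v.digit n := ⟨_, huv⟩
    have hle : PNat.find hex ≤ PNat.find hxz := PNat.find_min' hex huv
    have hle' : ((PNat.find hex : ℕ) : ℤ) ≤ ((PNat.find hxz : ℕ) : ℤ) := by exact_mod_cast hle
    have hcalc : (m : ℝ) ^ (-((PNat.find hxz : ℕ) : ℤ) + 1)
        ≤ (m : ℝ) ^ (-((PNat.find hex : ℕ) : ℤ) + 1) :=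
      zpow_le_zpow_right₀ hm (by omega)
    unfold rho
    rw [dif_pos hxz, dif_pos hex]
    convert hcalc
  by_cases hxy : x.digit (PNat.find hxz) = y.digit (PNat.find hxz)
  · refine le_max_of_le_right (key ?_)
    rw [← hxy]
    exact PNat.find_spec hxz
  · exact le_max_of_le_left (key hxy)

noncomputable instance instMetricSpace (m : ℕ) : MetricSpace (SeqSpace m) where
  dist := rho
  dist_self := rho_self
  dist_comm := rho_comm
  dist_triangle x y z :=
    (rho_triangle_max x y z).trans (max_le_add_of_nonneg (rho_nonneg x y) (rho_nonneg y z))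
  eq_of_dist_eq_zero := eq_of_rho_eq_zero

end SeqSpace

/-- The multiplicative shift of finite type `X_A = X_A^(q)`: all sequences `(x_k)` with
`A(x_k, x_{qk}) = 1` for all `k ≥ 1`. -/
def multShift {m : ℕ} (q : ℕ) (A : Matrix (Fin m) (Fin m) ℝ) : Set (SeqSpace m) :=
  {x | ∀ k l : ℕ+, (l : ℕ) = q * k → A (x.digit k) (x.digit l) = 1}

/-- `log N(r) / log (1 / r)`, where `N(r)` is the least number (possibly infinite) of closed balls
of radius `r` centred in `S` that cover `S`. -/
noncomputable def boxRatio {X : Type*} [PseudoEMetricSpace X] (S : Set X) (r : ℝ≥0) : EReal :=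
  ENNReal.log (Metric.coveringNumber r S : ℝ≥0∞) / ((Real.log (1 / (r : ℝ)) : ℝ) : EReal)

/-- Lower Minkowski (box-counting) dimension. -/
noncomputable def lowerMinkowskiDim {X : Type*} [PseudoEMetricSpace X] (S : Set X) : EReal :=
  liminf (boxRatio S) (𝓝[>] (0 : ℝ≥0))

/-- Upper Minkowski (box-counting) dimension. -/
noncomputable def upperMinkowskiDim {X : Type*} [PseudoEMetricSpace X] (S : Set X) : EReal :=
  limsup (boxRatio S) (𝓝[>] (0 : ℝ≥0))

/-- The Minkowski dimension of `S` exists (the lower and upper ones agree) and equals `d`. -/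
def HasMinkowskiDim {X : Type*} [PseudoEMetricSpace X] (S : Set X) (d : EReal) : Prop :=
  lowerMinkowskiDim S = d ∧ upperMinkowskiDim S = d

/-- `t` satisfies `t_i ^ q = ∑ j, A(i, j) t_j` and `t_i > 1` for all `i`. -/
def IsSolutionVector {m : ℕ} (q : ℕ) (A : Matrix (Fin m) (Fin m) ℝ) (t : Fin m → ℝ) : Prop :=
  ∀ i, t i ^ q = ∑ j, A i j * t j ∧ 1 < t i

/-! ### The solution vector as the fixed point of a contraction. -/

section SolutionVector

variable {m q : ℕ} {A : Matrix (Fin m) (Fin m) ℝ}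

/-! The condition defining `X_A` links only positions in the same geometric progression `i, iq, iq²,
…` with `q ∤ i`. Along each progression a point is a path in the graph of `A`, and different
progressions are independent.

Minkowski dimension: balls are cylinders, so coverings are counted by admissible prefixes. Their
number is a product over progressions of the word counts `N_k = (A^k 1, 1)`, and the densities of
progressions of each length give the series (`tendsto_log_card_admissibleWords_div`).

Hausdorff dimension: put on every progression an independent Markov chain with initial law `t_a /
T`, where `T = ∑ t_i`, and transitions `A(b,a) t_a / t_b^q`. With `S(n)` the sum of `log t` over the
first `n` letters, the cylinder of a point of `X_A` has log-mass `S(n) - q S(n/q) - (n - ⌊n/q⌋) log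
T` (`chainMeasure_cylinder`). By the law of large numbers `S(n)/n` converges almost surely, so the
first two terms cancel to `o(n)` and the mass distribution principle gives the lower bound. For the
upper bound take `n = q^k`: the first two terms are `n` times an increment of the nonnegative
sequence `S(q^k)/q^k`, and such increments cannot eventually stay below `-ε`. So every point lies in
infinitely many heavy cylinders, and these are few.

Comparison: let `W_k` sum `t` over the last letters of the words counted by `N_k`. Jensen and `A t =
t^q` give `(W_k/N_k)^q ≤ W_{k+1}/N_k`. Iterating its logarithm from `W_0 = T` bounds the Hausdorff
formula by the Minkowski one. The first step is strict unless `t` is constant, which means that the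
row sums agree. -/

lemma exists_entry_eq_one (hA01 : ∀ i j, A i j = 0 ∨ A i j = 1)
    (hA : A.IsPrimitive) (i : Fin m) : ∃ j, A i j = 1 := by
  obtain ⟨p, hp, hpos⟩ := hA.exists_pos_pow
  by_contra! h
  have h0 : ∀ j, A i j = 0 := fun j => (hA01 i j).resolve_right (h j)
  obtain ⟨r, rfl⟩ := Nat.exists_eq_succ_of_ne_zero hp.ne'
  have := hpos i i
  rw [pow_succ', Matrix.mul_apply] at this
  simp [h0] at this

/-- Integrality turns positivity of the entries of a power into the lower bound 1. -/
lemma exists_natCast_eq_pow_entry (hA01 : ∀ i j, A i j = 0 ∨ A i j = 1) (k : ℕ) :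
    ∀ i j, ∃ n : ℕ, (A ^ k) i j = n := by
  induction k with
  | zero =>
    intro i j
    by_cases h : i = j
    · exact ⟨1, by simp [h]⟩
    · exact ⟨0, by simp [h]⟩
  | succ k ih =>
    intro i j
    have h1 : ∀ i j, ∃ n : ℕ, A i j = n := fun i j => by
      rcases hA01 i j with h | h
      · exact ⟨0, by simp [h]⟩
      · exact ⟨1, by simp [h]⟩
    choose f hf using ih
    choose g hg using h1
    exact ⟨∑ l, f i l * g l j, by simp [pow_succ, Matrix.mul_apply, hf, hg]⟩

lemma mulVec_pos (hA01 : ∀ i j, A i j = 0 ∨ A i j = 1) (hA : A.IsPrimitive)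
    {v : Fin m → ℝ} (hv : ∀ i, 0 < v i) (i : Fin m) : 0 < ∑ j, A i j * v j := by
  obtain ⟨j, hj⟩ := exists_entry_eq_one hA01 hA i
  refine Finset.sum_pos' (fun j _ => mul_nonneg (hA.nonneg i j) (hv j).le) ⟨j, Finset.mem_univ _, ?_⟩
  simp [hj, hv]

/-- The map whose fixed points are the logarithms of the positive solutions of
`t_i ^ q = ∑ j, A(i, j) t_j`. -/
noncomputable def logStep (q : ℕ) (A : Matrix (Fin m) (Fin m) ℝ) (u : Fin m → ℝ) : Fin m → ℝ :=
  fun i => Real.log (∑ j, A i j * Real.exp (u j)) / q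

/-- Moving `u` by at most `δ` in the sup norm changes every exponential, hence every nonnegative
combination of them, by a factor at most `e^δ`. So the logarithm is 1-Lipschitz and the division by
`q` contracts. -/
lemma contractingWith_logStep (hq : 2 ≤ q)
    (hA01 : ∀ i j, A i j = 0 ∨ A i j = 1) (hA : A.IsPrimitive) :
    ContractingWith (1 / q : ℝ≥0) (logStep q A) := by
  have hq0 : (0 : ℝ) < q := by positivity
  refine ⟨?_, LipschitzWith.of_dist_le_mul fun u v => ?_⟩
  · rw [div_lt_one (by positivity)]
    exact_mod_cast (by omega : 1 < q)
  have key : ∀ (u v : Fin m → ℝ) (i : Fin m),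
      Real.log (∑ j, A i j * Real.exp (u j)) ≤
        Real.log (∑ j, A i j * Real.exp (v j)) + dist u v := by
    intro u v i
    have hpos := fun w : Fin m → ℝ => mulVec_pos hA01 hA (fun j => Real.exp_pos (w j)) i
    rw [← Real.log_exp (dist u v), ← Real.log_mul (hpos v).ne' (Real.exp_pos _).ne']
    refine Real.log_le_log (hpos u) ?_
    rw [Finset.sum_mul]
    refine Finset.sum_le_sum fun j _ => ?_
    rw [mul_assoc, ← Real.exp_add]
    refine mul_le_mul_of_nonneg_left (Real.exp_le_exp.2 ?_) (hA.nonneg i j)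
    have := (le_abs_self _).trans ((Real.dist_eq (u j) (v j)).symm.le.trans (dist_le_pi_dist u v j))
    linarith
  rw [dist_pi_le_iff (by positivity)]
  intro i
  have h1 := key u v i
  have h2 := key v u i
  rw [dist_comm v u] at h2
  have : ((1 / q : ℝ≥0) : ℝ) * dist u v = dist u v / q := by push_cast; ring
  rw [this, Real.dist_eq, logStep, logStep, ← sub_div, abs_div, abs_of_pos hq0]
  exact div_le_div_of_nonneg_right (abs_le.2 ⟨by linarith, by linarith⟩) hq0.le

lemma logStep_eq_self_iff (hq : 2 ≤ q) (hA01 : ∀ i j, A i j = 0 ∨ A i j = 1)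
    (hA : A.IsPrimitive) {u : Fin m → ℝ} :
    logStep q A u = u ↔ ∀ i, Real.exp (u i) ^ q = ∑ j, A i j * Real.exp (u j) := by
  have hq0 : (0 : ℝ) < q := by positivity
  rw [funext_iff]
  refine forall_congr' fun i => ?_
  have hpos := mulVec_pos hA01 hA (fun j => Real.exp_pos (u j)) i
  rw [logStep, div_eq_iff hq0.ne', ← Real.exp_nat_mul, mul_comm (u i)]
  constructor
  · intro h
    rw [← h, Real.exp_log hpos]
  · intro h
    rw [← h, Real.log_exp]

theorem existsUnique_isSolutionVector (hm : 2 ≤ m) (hq : 2 ≤ q)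
    (hA01 : ∀ i j, A i j = 0 ∨ A i j = 1) (hA : A.IsPrimitive) :
    ∃! t : Fin m → ℝ, IsSolutionVector q A t := by
  have hc := contractingWith_logStep hq hA01 hA
  have hq0 : (0 : ℝ) < q := by positivity
  set u := hc.fixedPoint with hu
  have hfix : logStep q A u = u := hc.fixedPoint_isFixedPt
  have hsol := (logStep_eq_self_iff hq hA01 hA).1 hfix
  have hnonneg : ∀ i, 0 ≤ u i := by
    -- The iterates started at 0 stay nonnegative because every row contains a 1, and they converge
    -- to the fixed point.
    have hit : ∀ n i, 0 ≤ ((logStep q A)^[n] 0) i := by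
      intro n
      induction n with
      | zero => simp
      | succ n ih =>
        intro i
        rw [Function.iterate_succ_apply']
        refine div_nonneg (Real.log_nonneg ?_) hq0.le
        obtain ⟨j, hj⟩ := exists_entry_eq_one hA01 hA i
        calc (1 : ℝ) ≤ A i j * Real.exp ((logStep q A)^[n] 0 j) := by
              rw [hj, one_mul]; exact Real.one_le_exp (ih j)
          _ ≤ _ := Finset.single_le_sum
              (f := fun j => A i j * Real.exp ((logStep q A)^[n] 0 j))
              (fun j _ => mul_nonneg (hA.nonneg i j) (Real.exp_pos _).le) (Finset.mem_univ j)
    intro i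
    exact ge_of_tendsto' ((tendsto_pi_nhds.1 (hc.tendsto_iterate_fixedPoint 0)) i)
      fun n => hit n i
  have hone : ∀ i, 1 ≤ Real.exp (u i) := fun i => Real.one_le_exp (hnonneg i)
  have hlt : ∀ i, 1 < Real.exp (u i) := by
    intro i
    refine (hone i).lt_of_ne' fun hi => ?_
    -- If `t_i = 1`, its row sum is 1 while all `t_j ≥ 1`, so every successor `j` also has `t_j =
    -- 1`. Hence the row `i` of every power, weighted by `t`, sums to 1; for a positive power that
    -- sum is at least `m`.
    have hstep : ∀ k, ∀ i, Real.exp (u i) = 1 → ∑ j, (A ^ k) i j * Real.exp (u j) = 1 := by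
      intro k
      induction k with
      | zero => intro i hi; simp [Matrix.one_apply, hi]
      | succ k ih =>
        intro i hi
        have hs : ∑ j, A i j * Real.exp (u j) = 1 := by rw [← hsol, hi, one_pow]
        have hsucc : ∀ j, A i j * ∑ l, (A ^ k) j l * Real.exp (u l) =
            A i j * Real.exp (u j) := by
          intro j
          rcases hA01 i j with h | h
          · simp [h]
          · have : A i j * Real.exp (u j) ≤ 1 := hs ▸ Finset.single_le_sum
              (f := fun j => A i j * Real.exp (u j))
              (fun j _ => mul_nonneg (hA.nonneg i j) (Real.exp_pos _).le) (Finset.mem_univ j)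
            rw [h, one_mul] at this
            have hj := this.antisymm (hone j)
            rw [ih j hj, hj]
        rw [← hs, ← Finset.sum_congr rfl fun j _ => hsucc j]
        simp_rw [pow_succ', Matrix.mul_apply, Finset.sum_mul, Finset.mul_sum]
        rw [Finset.sum_comm]
        simp [mul_assoc]
    obtain ⟨p, -, hpos⟩ := hA.exists_pos_pow
    have h1 : ∀ j, (1 : ℝ) ≤ (A ^ p) i j * Real.exp (u j) := by
      intro j
      obtain ⟨n, hn⟩ := exists_natCast_eq_pow_entry hA01 p i j
      have := hpos i j
      rw [hn] at this ⊢
      have : (1 : ℝ) ≤ n := by exact_mod_cast this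
      nlinarith [hone j]
    have h2 : (m : ℝ) ≤ ∑ j, (A ^ p) i j * Real.exp (u j) := by
      simpa using Finset.sum_le_sum fun j (_ : j ∈ Finset.univ) => h1 j
    rw [hstep p i hi] at h2
    have : m ≤ 1 := by exact_mod_cast h2
    omega
  refine ⟨fun i => Real.exp (u i), fun i => ⟨hsol i, hlt i⟩, fun t ht => ?_⟩
  have htpos : ∀ i, 0 < t i := fun i => zero_lt_one.trans (ht i).2
  have hexp : ∀ i, Real.exp (Real.log (t i)) = t i := fun i => Real.exp_log (htpos i)
  have : logStep q A (fun i => Real.log (t i)) = fun i => Real.log (t i) :=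
    (logStep_eq_self_iff hq hA01 hA).2 fun i => by simpa only [hexp] using (ht i).1
  have := hc.fixedPoint_unique this
  funext i
  rw [hu, ← this, hexp]

end SolutionVector

/-! ### Growth of the word counts and convergence of the series. -/

section WordCount

variable {m q : ℕ} {A : Matrix (Fin m) (Fin m) ℝ}

lemma pow_mulVec_one_bounds (hm : 2 ≤ m) (hA01 : ∀ i j, A i j = 0 ∨ A i j = 1)
    (hA : A.IsPrimitive) (k : ℕ) (i : Fin m) :
    1 ≤ ((A ^ k) *ᵥ 1) i ∧ ((A ^ k) *ᵥ 1) i ≤ (m : ℝ) ^ k := by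
  induction k generalizing i with
  | zero => simp
  | succ k ih =>
    rw [pow_succ', ← Matrix.mulVec_mulVec]
    set v := (A ^ k) *ᵥ (1 : Fin m → ℝ)
    constructor
    · obtain ⟨j, hj⟩ := exists_entry_eq_one hA01 hA i
      calc (1 : ℝ) ≤ A i j * v j := by rw [hj, one_mul]; exact (ih j).1
        _ ≤ ∑ j, A i j * v j := Finset.single_le_sum (f := fun j => A i j * v j)
            (fun j _ => mul_nonneg (hA.nonneg i j) (zero_le_one.trans (ih j).1)) (Finset.mem_univ j)
    · calc ∑ j, A i j * v j ≤ ∑ j : Fin m, (m : ℝ) ^ k := Finset.sum_le_sum fun j _ => by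
            rcases hA01 i j with h | h
            · rw [h, zero_mul]; positivity
            · rw [h, one_mul]; exact (ih j).2
        _ = (m : ℝ) ^ (k + 1) := by simp [pow_succ']

/-- The number of words of length `k + 1` admissible for the matrix `A`. -/
noncomputable def wordCount (A : Matrix (Fin m) (Fin m) ℝ) (k : ℕ) : ℝ := ((A ^ k) *ᵥ 1) ⬝ᵥ 1

lemma wordCount_eq_sum (k : ℕ) : wordCount A k = ∑ i, ((A ^ k) *ᵥ 1) i := by
  simp [wordCount, dotProduct]

lemma one_le_wordCount (hm : 2 ≤ m) (hA01 : ∀ i j, A i j = 0 ∨ A i j = 1)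
    (hA : A.IsPrimitive) (k : ℕ) : 1 ≤ wordCount A k := by
  have h := Finset.sum_le_sum fun i (_ : i ∈ Finset.univ) => (pow_mulVec_one_bounds hm hA01 hA k i).1
  rw [← wordCount_eq_sum] at h
  have hm' : (2 : ℝ) ≤ m := by exact_mod_cast hm
  simp at h
  linarith

lemma wordCount_le (hm : 2 ≤ m) (hA01 : ∀ i j, A i j = 0 ∨ A i j = 1)
    (hA : A.IsPrimitive) (k : ℕ) : wordCount A k ≤ (m : ℝ) ^ (k + 1) := by
  have h := Finset.sum_le_sum fun i (_ : i ∈ Finset.univ) => (pow_mulVec_one_bounds hm hA01 hA k i).2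
  rw [← wordCount_eq_sum] at h
  simpa [pow_succ'] using h

lemma log_wordCount_nonneg (hm : 2 ≤ m) (hA01 : ∀ i j, A i j = 0 ∨ A i j = 1)
    (hA : A.IsPrimitive) (k : ℕ) : 0 ≤ Real.log (wordCount A k) :=
  Real.log_nonneg (one_le_wordCount hm hA01 hA k)

lemma log_wordCount_le (hm : 2 ≤ m) (hA01 : ∀ i j, A i j = 0 ∨ A i j = 1)
    (hA : A.IsPrimitive) (k : ℕ) : Real.log (wordCount A k) ≤ (k + 1) * Real.log m := by
  have := Real.log_le_log (zero_lt_one.trans_le (one_le_wordCount hm hA01 hA k))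
    (wordCount_le hm hA01 hA k)
  rwa [Real.log_pow, Nat.cast_add_one] at this

lemma summable_add_one_div_pow (hq : 2 ≤ q) :
    Summable fun k : ℕ => ((k : ℝ) + 1) / (q : ℝ) ^ k := by
  have hr : ‖(1 / q : ℝ)‖ < 1 := by
    rw [Real.norm_of_nonneg (by positivity), div_lt_one (by positivity)]
    exact_mod_cast (by omega : 1 < q)
  have h1 := summable_pow_mul_geometric_of_norm_lt_one 1 hr
  have h0 := summable_pow_mul_geometric_of_norm_lt_one 0 hr
  refine (h1.add h0).congr fun k => ?_
  simp only [pow_one, pow_zero, one_div, inv_pow]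
  ring

lemma summable_log_wordCount (hm : 2 ≤ m) (hq : 2 ≤ q) (hA01 : ∀ i j, A i j = 0 ∨ A i j = 1)
    (hA : A.IsPrimitive) :
    Summable fun k : ℕ => Real.log (wordCount A k) / (q : ℝ) ^ k := by
  refine Summable.of_nonneg_of_le (fun k => div_nonneg (log_wordCount_nonneg hm hA01 hA k)
    (by positivity)) (fun k => ?_) ((summable_add_one_div_pow hq).mul_right (Real.log m))
  rw [div_mul_eq_mul_div]
  exact div_le_div_of_nonneg_right (log_wordCount_le hm hA01 hA k) (by positivity)

end WordCount

/-! ### Comparison of the two formulas by Jensen's inequality. -/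

section WeightedCount

variable {m q : ℕ} {A : Matrix (Fin m) (Fin m) ℝ} {t : Fin m → ℝ}

/-- The sum of `t` evaluated at the last letters of all admissible words of length `k + 1`. -/
noncomputable def weightedCount (A : Matrix (Fin m) (Fin m) ℝ) (t : Fin m → ℝ) (k : ℕ) : ℝ :=
  (1 ᵥ* (A ^ k)) ⬝ᵥ t

lemma sum_vecMul_eq_wordCount (k : ℕ) : ∑ i, (1 ᵥ* (A ^ k)) i = wordCount A k := by
  rw [wordCount, dotProduct_comm, Matrix.dotProduct_mulVec]
  simp [dotProduct]

lemma vecMul_nonneg (hA : A.IsPrimitive) (k : ℕ) (i : Fin m) : 0 ≤ (1 ᵥ* (A ^ k)) i := by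
  induction k generalizing i with
  | zero => simp
  | succ k ih =>
    rw [pow_succ, ← Matrix.vecMul_vecMul]
    exact Finset.sum_nonneg (s := Finset.univ) fun j _ => mul_nonneg (ih j) (hA.nonneg j i)

lemma weightedCount_succ (ht : IsSolutionVector q A t) (k : ℕ) :
    weightedCount A t (k + 1) = ∑ i, (1 ᵥ* (A ^ k)) i * t i ^ q := by
  rw [weightedCount, pow_succ, ← Matrix.vecMul_vecMul, ← Matrix.dotProduct_mulVec]
  exact Finset.sum_congr rfl fun i _ => by rw [(ht i).1]; rfl

lemma wordCount_le_weightedCount (hA : A.IsPrimitive) (ht : IsSolutionVector q A t) (k : ℕ) :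
    wordCount A k ≤ weightedCount A t k := by
  rw [← sum_vecMul_eq_wordCount]
  exact Finset.sum_le_sum fun i _ => le_mul_of_one_le_right (vecMul_nonneg hA k i) (ht i).2.le

lemma weightedCount_le (hA : A.IsPrimitive) (ht : IsSolutionVector q A t) (k : ℕ) :
    weightedCount A t k ≤ wordCount A k * ∑ i, t i := by
  rw [← sum_vecMul_eq_wordCount, Finset.sum_mul]
  exact Finset.sum_le_sum (s := Finset.univ) fun i _ => mul_le_mul_of_nonneg_left
    (Finset.single_le_sum (fun j _ => (zero_lt_one.trans (ht j).2).le) (Finset.mem_univ i))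
    (vecMul_nonneg hA k i)

/-- Jensen for `x ↦ x^q`, averaging `t` over the law of the last letter of a uniformly chosen
admissible word. -/
lemma weightedCount_pow_le (hm : 2 ≤ m) (hA01 : ∀ i j, A i j = 0 ∨ A i j = 1)
    (hA : A.IsPrimitive) (ht : IsSolutionVector q A t) (k : ℕ) :
    (weightedCount A t k / wordCount A k) ^ q ≤ weightedCount A t (k + 1) / wordCount A k := by
  have hN := zero_lt_one.trans_le (one_le_wordCount hm hA01 hA k)
  have := Real.pow_arith_mean_le_arith_mean_pow Finset.univ
    (fun i => (1 ᵥ* (A ^ k)) i / wordCount A k) t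
    (fun i _ => div_nonneg (vecMul_nonneg hA k i) hN.le)
    (by rw [← Finset.sum_div, sum_vecMul_eq_wordCount, div_self hN.ne'])
    (fun i _ => (zero_lt_one.trans (ht i).2).le) q
  simp_rw [div_mul_eq_mul_div, ← Finset.sum_div, ← weightedCount_succ ht] at this
  exact this

lemma log_le_of_div_pow_le (hq : 2 ≤ q) {W N W' : ℝ} (hW : 0 < W) (hN : 0 < N) (hW' : 0 < W') :
    ((W / N) ^ q ≤ W' / N →
      Real.log W ≤ (1 - 1 / q) * Real.log N + Real.log W' / q) ∧
    ((W / N) ^ q < W' / N →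
      Real.log W < (1 - 1 / q) * Real.log N + Real.log W' / q) := by
  have hq0 : (0 : ℝ) < q := by positivity
  have e1 : Real.log ((W / N) ^ q) = q * (Real.log W - Real.log N) := by
    rw [Real.log_pow, Real.log_div hW.ne' hN.ne']
  have e2 : Real.log (W' / N) = Real.log W' - Real.log N := Real.log_div hW'.ne' hN.ne'
  have e3 : (1 - 1 / q) * Real.log N + Real.log W' / q - Real.log W =
      (Real.log (W' / N) - Real.log ((W / N) ^ q)) / q := by
    rw [e1, e2]; field_simp; ring
  constructor
  · intro h
    have := Real.log_le_log (by positivity) h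
    rw [← sub_nonneg, e3]
    exact div_nonneg (sub_nonneg.2 this) hq0.le
  · intro h
    have := Real.log_lt_log (by positivity) h
    rw [← sub_pos, e3]
    exact div_pos (sub_pos.2 this) hq0

/-- Iterated logarithmic Jensen; the remainder vanishes since `N_k ≤ W_k ≤ N_k T`. A general
starting index `s` is allowed so that the step from 0 to 1 can be treated separately, with strict
inequality. -/
lemma log_weightedCount_le_tsum (hm : 2 ≤ m) (hq : 2 ≤ q)
    (hA01 : ∀ i j, A i j = 0 ∨ A i j = 1) (hA : A.IsPrimitive) (ht : IsSolutionVector q A t)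
    (s : ℕ) :
    Real.log (weightedCount A t s) ≤
      (1 - 1 / q) * ∑' k : ℕ, Real.log (wordCount A (s + k)) / (q : ℝ) ^ k := by
  have hq0 : (0 : ℝ) < q := by positivity
  have hN := fun k => zero_lt_one.trans_le (one_le_wordCount hm hA01 hA k)
  have hW := fun k => (hN k).trans_le (wordCount_le_weightedCount hA ht k)
  have hfin : ∀ K, Real.log (weightedCount A t s) ≤
      (1 - 1 / q) * ∑ k ∈ Finset.range K, Real.log (wordCount A (s + k)) / (q : ℝ) ^ k +
        Real.log (weightedCount A t (s + K)) / (q : ℝ) ^ K := by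
    intro K
    induction K with
    | zero => simp
    | succ K ih =>
      refine ih.trans ?_
      have h := (log_le_of_div_pow_le hq (hW (s + K)) (hN (s + K)) (hW (s + K + 1))).1
        (weightedCount_pow_le hm hA01 hA ht (s + K))
      have h' := div_le_div_of_nonneg_right h (by positivity : (0 : ℝ) ≤ (q : ℝ) ^ K)
      rw [Finset.sum_range_succ, ← add_assoc s K 1]
      calc _ ≤ _ := add_le_add le_rfl h'
        _ = _ := by rw [pow_succ]; field_simp; ring
  have hsum : Summable fun k : ℕ => Real.log (wordCount A (s + k)) / (q : ℝ) ^ k := by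
    have := ((summable_nat_add_iff s).2 (summable_log_wordCount hm hq hA01 hA)).mul_left
      ((q : ℝ) ^ s)
    refine this.congr fun k => ?_
    rw [add_comm k s, pow_add]
    field_simp
  have hT1 : 1 ≤ ∑ i, t i := by
    have h := Finset.single_le_sum (fun j _ => (zero_lt_one.trans (ht j).2).le)
      (Finset.mem_univ (⟨0, by omega⟩ : Fin m))
    exact (ht _).2.le.trans h
  have hlim : Tendsto (fun K => Real.log (weightedCount A t (s + K)) / (q : ℝ) ^ K) atTop (𝓝 0) := by
    have hpow : Tendsto (fun K : ℕ => Real.log (∑ i, t i) / (q : ℝ) ^ K) atTop (𝓝 0) :=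
      tendsto_const_nhds.div_atTop (tendsto_pow_atTop_atTop_of_one_lt
        (by exact_mod_cast (by omega : 1 < q)))
    have hub := hsum.tendsto_atTop_zero.add hpow
    rw [add_zero] at hub
    refine squeeze_zero (fun K => div_nonneg (Real.log_nonneg ?_) (by positivity))
      (fun K => ?_) hub
    · exact (one_le_wordCount hm hA01 hA _).trans (wordCount_le_weightedCount hA ht _)
    · rw [← add_div, ← Real.log_mul (hN _).ne' (by positivity)]
      exact div_le_div_of_nonneg_right (Real.log_le_log (hW _) (weightedCount_le hA ht _))
        (by positivity)
  have := (hsum.hasSum.tendsto_sum_nat.const_mul (1 - 1 / (q : ℝ))).add hlim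
  rw [add_zero] at this
  exact ge_of_tendsto' this hfin

lemma weightedCount_zero : weightedCount A t 0 = ∑ i, t i := by
  simp [weightedCount, dotProduct]

/-- The Hausdorff dimension is at most the Minkowski dimension, with equality only if `t` is
constant. -/
theorem eq_of_log_sum_eq_tsum (hm : 2 ≤ m) (hq : 2 ≤ q)
    (hA01 : ∀ i j, A i j = 0 ∨ A i j = 1) (hA : A.IsPrimitive) (ht : IsSolutionVector q A t)
    (h : Real.log (∑ i, t i) = (1 - 1 / q) * ∑' k : ℕ, Real.log (wordCount A k) / (q : ℝ) ^ k)
    (i j : Fin m) : t i = t j := by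
  by_contra hij
  have hq0 : (0 : ℝ) < q := by positivity
  have hm0 : (0 : ℝ) < m := by positivity
  have hN := fun k => zero_lt_one.trans_le (one_le_wordCount hm hA01 hA k)
  have hW := fun k => (hN k).trans_le (wordCount_le_weightedCount hA ht k)
  -- At level 0 the words are single letters, so the weights are uniform and positive, and strict
  -- convexity applies to any non-constant `t`.
  have hstrict : (weightedCount A t 0 / wordCount A 0) ^ q <
      weightedCount A t 1 / wordCount A 0 := by
    have := (strictConvexOn_pow hq).map_sum_lt (t := Finset.univ) (w := fun _ => 1 / (m : ℝ))
      (p := t) (fun _ _ => by positivity) (by simp [hm0.ne'])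
      (fun i _ => (zero_lt_one.trans (ht i).2).le) ⟨i, Finset.mem_univ _, j, Finset.mem_univ _, hij⟩
    rw [weightedCount_succ ht, weightedCount_zero, wordCount_eq_sum]
    simpa [← Finset.mul_sum, div_eq_inv_mul] using this
  have h0 := (log_le_of_div_pow_le hq (hW 0) (hN 0) (hW 1)).2 hstrict
  have h1 := log_weightedCount_le_tsum hm hq hA01 hA ht 1
  have hsplit := (summable_log_wordCount hm hq hA01 hA).tsum_eq_zero_add
  have hshift : ∑' k : ℕ, Real.log (wordCount A (k + 1)) / (q : ℝ) ^ (k + 1) =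
      (∑' k : ℕ, Real.log (wordCount A (1 + k)) / (q : ℝ) ^ k) / q := by
    rw [← tsum_div_const]
    refine tsum_congr fun k => ?_
    rw [add_comm 1 k, pow_succ, div_div]
  rw [hsplit, hshift, pow_zero, div_one, ← weightedCount_zero (A := A)] at h
  have h1' := div_le_div_of_nonneg_right h1 hq0.le
  rw [h, mul_add, mul_div_assoc'] at h0
  linarith

lemma pow_mulVec_one_of_mulVec_one {c : ℝ} (hc : A *ᵥ 1 = c • (1 : Fin m → ℝ)) (k : ℕ) :
    (A ^ k) *ᵥ 1 = c ^ k • (1 : Fin m → ℝ) := by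
  induction k with
  | zero => simp
  | succ k ih =>
    rw [pow_succ, ← Matrix.mulVec_mulVec, hc, Matrix.mulVec_smul, ih, smul_smul, pow_succ']

/-- At a maximum of `t` the equation gives `t^q ≤ c t`, at a minimum the reverse, so all values are
squeezed together. -/
lemma isSolutionVector_pow_eq {c : ℝ} (hm : 2 ≤ m) (hq : 2 ≤ q) (hA : A.IsPrimitive)
    (ht : IsSolutionVector q A t) (hc : A *ᵥ 1 = c • (1 : Fin m → ℝ)) (i : Fin m) :
    t i ^ (q - 1) = c := by
  have hrow : ∀ i, ∑ j, A i j = c := fun i => by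
    simpa [Matrix.mulVec, dotProduct] using congrFun hc i
  have htpos : ∀ i, 0 < t i := fun i => zero_lt_one.trans (ht i).2
  have : Nonempty (Fin m) := ⟨⟨0, by omega⟩⟩
  obtain ⟨a, ha⟩ := Finite.exists_max t
  obtain ⟨b, hb⟩ := Finite.exists_min t
  have hpow : ∀ i, t i ^ q = t i ^ (q - 1) * t i := fun i => by
    rw [← pow_succ, Nat.sub_add_cancel (by omega)]
  have h1 : t a ^ (q - 1) ≤ c := by
    refine le_of_mul_le_mul_right ?_ (htpos a)
    rw [← hpow, (ht a).1, ← hrow a, Finset.sum_mul]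
    exact Finset.sum_le_sum fun j _ => mul_le_mul_of_nonneg_left (ha j) (hA.nonneg a j)
  have h2 : c ≤ t b ^ (q - 1) := by
    refine le_of_mul_le_mul_right ?_ (htpos b)
    rw [← hpow, (ht b).1, ← hrow b, Finset.sum_mul]
    exact Finset.sum_le_sum fun j _ => mul_le_mul_of_nonneg_left (hb j) (hA.nonneg b j)
  exact le_antisymm ((pow_le_pow_left₀ (htpos i).le (ha i) _).trans h1)
    (h2.trans (pow_le_pow_left₀ (htpos b).le (hb i) _))

/-- If all row sums of `A` are equal then the two dimension formulas agree. -/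
theorem log_sum_eq_tsum_of_mulVec_one (hm : 2 ≤ m) (hq : 2 ≤ q) (hA : A.IsPrimitive)
    (ht : IsSolutionVector q A t) {c : ℝ} (hc : A *ᵥ 1 = c • (1 : Fin m → ℝ)) :
    Real.log (∑ i, t i) = (1 - 1 / q) * ∑' k : ℕ, Real.log (wordCount A k) / (q : ℝ) ^ k := by
  have hq1 : (1 : ℝ) < q := by exact_mod_cast (by omega : 1 < q)
  have hm0 : (0 : ℝ) < m := by positivity
  have hpow := isSolutionVector_pow_eq hm hq hA ht hc
  set a : Fin m := ⟨0, by omega⟩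
  have ha : 0 < t a := zero_lt_one.trans (ht a).2
  have hc0 : 0 < c := hpow a ▸ pow_pos ha _
  have hconst : ∀ i, t i = t a := fun i =>
    (pow_left_inj₀ (zero_lt_one.trans (ht i).2).le ha.le (by omega)).1 ((hpow i).trans (hpow a).symm)
  have hlog : Real.log (t a) = Real.log c / (q - 1) := by
    rw [← hpow a, Real.log_pow, Nat.cast_sub (by omega), Nat.cast_one,
      mul_div_cancel_left₀ _ (by linarith)]
  have hsum : Real.log (∑ i, t i) = Real.log m + Real.log c / (q - 1) := by
    simp only [hconst, Finset.sum_const, Finset.card_univ, Fintype.card_fin, nsmul_eq_mul]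
    rw [Real.log_mul hm0.ne' ha.ne', hlog]
  have hr : ‖(1 / q : ℝ)‖ < 1 := by
    rw [Real.norm_of_nonneg (by positivity), div_lt_one (by positivity)]
    exact hq1
  have hterm : ∀ k : ℕ, Real.log (wordCount A k) / (q : ℝ) ^ k =
      (1 / q : ℝ) ^ k * Real.log m + k * (1 / q : ℝ) ^ k * Real.log c := by
    intro k
    have : wordCount A k = m * c ^ k := by
      rw [wordCount, pow_mulVec_one_of_mulVec_one hc]
      simp [mul_comm]
    rw [this, Real.log_mul hm0.ne' (by positivity), Real.log_pow, one_div, inv_pow]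
    ring
  have hg := (hasSum_geometric_of_norm_lt_one hr).mul_right (Real.log m)
  have hg' := (hasSum_coe_mul_geometric_of_norm_lt_one hr).mul_right (Real.log c)
  rw [tsum_congr hterm, (hg.add hg').tsum_eq, hsum]
  have : (q : ℝ) - 1 ≠ 0 := by linarith
  field_simp

end WeightedCount

/-! ### Closed balls are cylinders. -/

section Metric

variable {m : ℕ}

lemma SeqSpace.dist_eq_zpow {x y : SeqSpace m} {p : ℕ+} (hp : x.digit p ≠ y.digit p)
    (hlt : ∀ k < p, x.digit k = y.digit k) : dist x y = (m : ℝ) ^ (-((p : ℕ) : ℤ) + 1) := by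
  classical
  have hex : ∃ n : ℕ+, x.digit n ≠ y.digit n := ⟨p, hp⟩
  have hfind : PNat.find hex = p :=
    (PNat.find_eq_iff hex).2 ⟨hp, fun k hk => not_not.2 (hlt k hk)⟩
  change rho x y = _
  have hcalc : (m : ℝ) ^ (-((PNat.find hex : ℕ) : ℤ) + 1) = (m : ℝ) ^ (-((p : ℕ) : ℤ) + 1) := by
    rw [hfind]
  rw [rho, dif_pos hex]
  convert hcalc

/-- A first disagreement at `p` means distance `m^(1-p)`, and no such value lies strictly between
`m^(-n)` and `m^(1-n)`. -/
lemma SeqSpace.dist_le_iff (hm : 2 ≤ m) {x y : SeqSpace m} {n : ℕ} {r : ℝ}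
    (hr : ((m : ℝ) ^ n)⁻¹ ≤ r) (hr' : r < ((m : ℝ) ^ n)⁻¹ * m) :
    dist x y ≤ r ↔ ∀ k : ℕ+, (k : ℕ) ≤ n → x.digit k = y.digit k := by
  classical
  have hm1 : (1 : ℝ) < m := by exact_mod_cast (by omega : 1 < m)
  have hm0 : (0 : ℝ) < m := by positivity
  by_cases hxy : ∃ k : ℕ+, x.digit k ≠ y.digit k
  · have hp := PNat.find_spec hxy
    have hlt : ∀ k < PNat.find hxy, x.digit k = y.digit k :=
      fun k hk => not_not.1 (PNat.find_min hxy hk)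
    set p := PNat.find hxy
    rw [dist_eq_zpow hp hlt]
    constructor
    · intro h k hk
      refine hlt k (PNat.coe_lt_coe _ _ |>.1 (lt_of_le_of_lt hk ?_))
      by_contra! hpn
      have hpn' : (p : ℕ) ≤ n := hpn
      refine (h.trans_lt hr').not_ge ?_
      rw [← zpow_natCast, ← zpow_neg, ← zpow_add_one₀ hm0.ne']
      exact zpow_le_zpow_right₀ hm1.le (by omega)
    · intro h
      have hnp : n < (p : ℕ) := by
        by_contra! hpn
        exact hp (h p hpn)
      refine le_trans ?_ hr
      rw [← zpow_natCast, ← zpow_neg]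
      exact zpow_le_zpow_right₀ hm1.le (by omega)
  · push Not at hxy
    have : x = y := SeqSpace.ext (funext hxy)
    subst this
    simp only [dist_self, implies_true, iff_true]
    exact le_trans (by positivity) hr

lemma SeqSpace.dist_le_inv_pow_iff (hm : 2 ≤ m) {x y : SeqSpace m} {n : ℕ} :
    dist x y ≤ ((m : ℝ) ^ n)⁻¹ ↔ ∀ k : ℕ+, (k : ℕ) ≤ n → x.digit k = y.digit k := by
  refine dist_le_iff hm le_rfl (lt_mul_of_one_lt_right (by positivity) ?_)
  exact_mod_cast (by omega : 1 < m)

end Metric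

/-! ### Splitting `{1, …, n}` into geometric progressions of ratio `q`. -/

section Multiples

variable {q : ℕ}

/-- The number of times `q` divides `k`. -/
noncomputable def chainPos (q k : ℕ) : ℕ := multiplicity q k

/-- The part of `k` that is left when all factors `q` are divided out. -/
noncomputable def chainRoot (q k : ℕ) : ℕ := k / q ^ chainPos q k

lemma chainRoot_mul_pow (q k : ℕ) : chainRoot q k * q ^ chainPos q k = k :=
  Nat.div_mul_cancel (pow_multiplicity_dvd q k)

lemma not_dvd_chainRoot (hq : 2 ≤ q) {k : ℕ} (hk : 0 < k) : ¬ q ∣ chainRoot q k := by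
  have hfin : FiniteMultiplicity q k := Nat.finiteMultiplicity_iff.2 ⟨by omega, hk⟩
  intro h
  have := mul_dvd_mul_right h (q ^ chainPos q k)
  rw [chainRoot_mul_pow, ← pow_succ'] at this
  exact hfin.not_pow_dvd_of_multiplicity_lt (Nat.lt_succ_self _) this

lemma chainPos_mul_pow (hq : 2 ≤ q) {i : ℕ} (hi : ¬ q ∣ i) (j : ℕ) :
    chainPos q (i * q ^ j) = j := by
  refine multiplicity_eq_of_dvd_of_not_dvd (Dvd.intro_left i rfl) ?_
  rw [pow_succ']
  exact fun h => hi (Nat.dvd_of_mul_dvd_mul_right (by positivity) h)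

lemma chainRoot_mul_pow_eq (hq : 2 ≤ q) {i : ℕ} (hi : ¬ q ∣ i) (j : ℕ) :
    chainRoot q (i * q ^ j) = i := by
  rw [chainRoot, chainPos_mul_pow hq hi, Nat.mul_div_cancel _ (by positivity)]

lemma chainPos_mul (hq : 2 ≤ q) {k : ℕ} (hk : 0 < k) :
    chainPos q (k * q) = chainPos q k + 1 := by
  conv_lhs => rw [← chainRoot_mul_pow q k, mul_assoc, ← pow_succ]
  exact chainPos_mul_pow hq (not_dvd_chainRoot hq hk) _

lemma chainRoot_mul (hq : 2 ≤ q) {k : ℕ} (hk : 0 < k) :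
    chainRoot q (k * q) = chainRoot q k := by
  conv_lhs => rw [← chainRoot_mul_pow q k, mul_assoc, ← pow_succ]
  exact chainRoot_mul_pow_eq hq (not_dvd_chainRoot hq hk) _

lemma chainPos_of_not_dvd (hq : 2 ≤ q) {k : ℕ} (hk : ¬ q ∣ k) : chainPos q k = 0 := by
  simpa using chainPos_mul_pow hq hk 0

/-- The integers in `[1, n]` that are not multiples of `q`. -/
def nonmultiples (q n : ℕ) : Finset ℕ := {i ∈ Finset.Icc 1 n | ¬ q ∣ i}

lemma mem_nonmultiples {n i : ℕ} : i ∈ nonmultiples q n ↔ i ≤ n ∧ ¬ q ∣ i := by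
  simp only [nonmultiples, Finset.mem_filter, Finset.mem_Icc]
  refine ⟨fun h => ⟨h.1.2, h.2⟩, fun h => ⟨⟨?_, h.1⟩, h.2⟩⟩
  by_contra h0
  exact h.2 (by simp [(by omega : i = 0)])

lemma sum_filter_dvd_Icc {M : Type*} [AddCommMonoid M] (hq : 2 ≤ q) (n : ℕ) (F : ℕ → M) :
    ∑ k ∈ Finset.Icc 1 n with q ∣ k, F k = ∑ k ∈ Finset.Icc 1 (n / q), F (k * q) := by
  symm
  refine Finset.sum_nbij' (· * q) (· / q) ?_ ?_ ?_ ?_ ?_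
  · intro k hk
    simp only [Finset.mem_Icc, Finset.mem_filter] at hk ⊢
    exact ⟨⟨Nat.mul_pos hk.1 (by omega), (Nat.le_div_iff_mul_le (by omega)).1 hk.2⟩,
      Dvd.intro_left k rfl⟩
  · intro k hk
    simp only [Finset.mem_Icc, Finset.mem_filter] at hk ⊢
    exact ⟨Nat.div_pos (Nat.le_of_dvd hk.1.1 hk.2) (by omega), Nat.div_le_div_right hk.1.2⟩
  · intro k _
    exact Nat.mul_div_cancel _ (by omega)
  · intro k hk
    exact Nat.div_mul_cancel (Finset.mem_filter.1 hk).2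
  · intros; rfl

lemma sum_Icc_eq_nonmultiples_add {M : Type*} [AddCommMonoid M] (hq : 2 ≤ q) (n : ℕ)
    (F : ℕ → M) :
    ∑ k ∈ Finset.Icc 1 n, F k =
      ∑ i ∈ nonmultiples q n, F i + ∑ k ∈ Finset.Icc 1 (n / q), F (k * q) := by
  rw [← sum_filter_dvd_Icc hq, nonmultiples, add_comm]
  exact (Finset.sum_filter_add_sum_filter_not _ _ _).symm

/-- Split off the non-multiples of `q`, rescale the multiples and repeat; `n` rounds suffice because
`q^n > n`. -/
lemma sum_Icc_eq_sum_chains {M : Type*} [AddCommMonoid M] (hq : 2 ≤ q) (n : ℕ) (F : ℕ → M) :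
    ∑ k ∈ Finset.Icc 1 n, F k =
      ∑ j ∈ Finset.range n, ∑ i ∈ nonmultiples q (n / q ^ j), F (i * q ^ j) := by
  have h : ∀ J, ∑ k ∈ Finset.Icc 1 n, F k =
      ∑ j ∈ Finset.range J, ∑ i ∈ nonmultiples q (n / q ^ j), F (i * q ^ j) +
        ∑ k ∈ Finset.Icc 1 (n / q ^ J), F (k * q ^ J) := by
    intro J
    induction J with
    | zero => simp
    | succ J ih =>
      rw [ih, sum_Icc_eq_nonmultiples_add hq (n / q ^ J), Finset.sum_range_succ, ← add_assoc,
        Nat.div_div_eq_div_mul, ← pow_succ]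
      simp [pow_succ', mul_assoc]
  have h0 : n / q ^ n = 0 := Nat.div_eq_of_lt (Nat.lt_pow_self (by omega))
  simpa [h0] using h n

lemma card_nonmultiples (hq : 2 ≤ q) (n : ℕ) :
    ((nonmultiples q n).card : ℝ) = n - (n / q : ℕ) := by
  have := sum_Icc_eq_nonmultiples_add hq n (fun _ => (1 : ℝ))
  simp at this
  linarith

lemma tendsto_natDiv_div {d : ℕ} (hd : 0 < d) :
    Tendsto (fun n : ℕ => ((n / d : ℕ) : ℝ) / n) atTop (𝓝 (1 / d)) := by
  have h := (tendsto_nat_floor_mul_div_atTop (R := ℝ) (a := 1 / d) (by positivity)).comp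
    tendsto_natCast_atTop_atTop
  refine h.congr fun n => ?_
  rw [Function.comp_apply, one_div_mul_eq_div, Nat.floor_div_eq_div]

lemma tendsto_natDiv_atTop {d : ℕ} (hd : 0 < d) :
    Tendsto (fun n : ℕ => n / d) atTop atTop :=
  Nat.tendsto_div_const_atTop hd.ne'

/-- Dominated convergence over the levels `j`, with dominating series `C j / q^j`. The bound forces
`V j 0 = 0`, so levels `j ≥ n` vanish and the finite sum is a full series. This serves both the word
count and the law of large numbers. -/
lemma tendsto_sum_chains_div (hq : 2 ≤ q) {V : ℕ → ℕ → ℝ} {c C : ℕ → ℝ}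
    (hV : ∀ j, Tendsto (fun N : ℕ => V j N / N) atTop (𝓝 (c j)))
    (hb : ∀ j N, |V j N| ≤ C j * N) (hC : Summable fun j => C j / (q : ℝ) ^ j) :
    Tendsto (fun n : ℕ => (∑ j ∈ Finset.range n, V j (n / q ^ j)) / n) atTop
      (𝓝 (∑' j, c j / (q : ℝ) ^ j)) := by
  have hV0 : ∀ j, V j 0 = 0 := fun j => by simpa using hb j 0
  have hC0 : ∀ j, 0 ≤ C j := fun j => by simpa using (abs_nonneg _).trans (hb j 1)
  have hlim := tendsto_tsum_of_dominated_convergence (𝓕 := atTop)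
    (f := fun (n : ℕ) j => V j (n / q ^ j) / n) (g := fun j => c j / (q : ℝ) ^ j) hC
    (fun j => ?_) (Eventually.of_forall fun n j => ?_)
  · refine hlim.congr fun n => ?_
    rw [tsum_eq_sum (s := Finset.range n), Finset.sum_div]
    intro j hj
    have : n / q ^ j = 0 := Nat.div_eq_of_lt
      ((Nat.lt_pow_self (by omega)).trans_le (Nat.pow_le_pow_right (by omega)
        (not_lt.1 fun h => hj (Finset.mem_range.2 h))))
    rw [this, hV0, zero_div]
  · have hpos : 0 < q ^ j := by positivity
    have h := ((hV j).comp (tendsto_natDiv_atTop hpos)).mul (tendsto_natDiv_div hpos)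
    rw [mul_one_div, Nat.cast_pow] at h
    refine h.congr fun n => ?_
    by_cases h0 : ((n / q ^ j : ℕ) : ℝ) = 0
    · have : n / q ^ j = 0 := by exact_mod_cast h0
      simp [this, hV0]
    · simp only [Function.comp_apply]
      field_simp
  · rw [Real.norm_eq_abs, abs_div, Nat.abs_cast]
    rcases Nat.eq_zero_or_pos n with rfl | hn
    · simpa using div_nonneg (hC0 j) (by positivity)
    · have hn' : (0 : ℝ) < n := by exact_mod_cast hn
      rw [div_le_iff₀ hn', div_mul_eq_mul_div, mul_div_assoc]
      refine (hb j _).trans (mul_le_mul_of_nonneg_left ?_ (hC0 j))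
      have := Nat.cast_div_le (α := ℝ) (m := n) (n := q ^ j)
      rwa [Nat.cast_pow] at this

end Multiples

/-! ### Building points progression by progression. -/

section Chains

variable {m q : ℕ} {A : Matrix (Fin m) (Fin m) ℝ}

/-- The sequence generated by the update rules `U j`, which map the previous letter (`none` at the
start) to the next one. -/
def chainSeq {α : Type*} (U : ℕ → Option α → α) : ℕ → α
  | 0 => U 0 none
  | j + 1 => U (j + 1) (some (chainSeq U j))

/-- The point whose restriction to the geometric progression `i, i q, i q², …` is generated by the
update rules `ω i`, for all `i` not divisible by `q`. -/
noncomputable def chainPoint (q : ℕ) (ω : ℕ → ℕ → Option (Fin m) → Fin m) : SeqSpace m :=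
  ⟨fun k => chainSeq (ω (chainRoot q k)) (chainPos q k)⟩

lemma chainPoint_digit_of_not_dvd (hq : 2 ≤ q) (ω : ℕ → ℕ → Option (Fin m) → Fin m) {k : ℕ+}
    (hk : ¬ q ∣ (k : ℕ)) :
    (chainPoint q ω).digit k = ω (chainRoot q k) (chainPos q k) none := by
  rw [chainPoint]
  simp only [chainPos_of_not_dvd hq hk, chainSeq]

lemma chainPoint_digit_mul (hq : 2 ≤ q) (ω : ℕ → ℕ → Option (Fin m) → Fin m) {k l : ℕ+}
    (hl : (l : ℕ) = k * q) :
    (chainPoint q ω).digit l =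
      ω (chainRoot q l) (chainPos q l) (some ((chainPoint q ω).digit k)) := by
  simp only [chainPoint, hl, chainPos_mul hq k.pos, chainRoot_mul hq k.pos, chainSeq]

/-- The word `x_1 … x_n`. -/
def prefixWord (n : ℕ) (x : SeqSpace m) : Finset.Icc 1 n → Fin m :=
  fun k => x.digit ⟨k, (Finset.mem_Icc.1 k.2).1⟩

lemma prefixWord_eq_iff {n : ℕ} {x y : SeqSpace m} :
    prefixWord n x = prefixWord n y ↔ ∀ k : ℕ+, (k : ℕ) ≤ n → x.digit k = y.digit k := by
  constructor
  · intro h k hk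
    exact congrFun h ⟨k, Finset.mem_Icc.2 ⟨k.pos, hk⟩⟩
  · intro h
    funext k
    exact h _ (Finset.mem_Icc.1 k.2).2

/-- The words `x_1 … x_n` with `A(x_k, x_{qk}) = 1` for all `k ≤ n / q`. -/
def admissibleWords (q : ℕ) (A : Matrix (Fin m) (Fin m) ℝ) (n : ℕ) :
    Set (Finset.Icc 1 n → Fin m) :=
  {w | ∀ k l : Finset.Icc 1 n, (l : ℕ) = k * q → A (w k) (w l) = 1}

lemma prefixWord_image_multShift (hm : 2 ≤ m) (hq : 2 ≤ q)
    (hA01 : ∀ i j, A i j = 0 ∨ A i j = 1) (hA : A.IsPrimitive) (n : ℕ) :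
    prefixWord n '' multShift q A = admissibleWords q A n := by
  apply Set.Subset.antisymm
  · rintro _ ⟨x, hx, rfl⟩ k l hl
    exact hx _ _ (by simpa [mul_comm] using hl)
  · intro w hw
    choose nxt hnxt using exists_entry_eq_one hA01 hA
    -- Positions up to `n` copy `w`, later ones continue with an allowed successor. Progressions
    -- starting beyond `n` begin with the arbitrary letter 0.
    let ω : ℕ → ℕ → Option (Fin m) → Fin m := fun i j o =>
      if h : i * q ^ j ∈ Finset.Icc 1 n then w ⟨i * q ^ j, h⟩
      else (o.map nxt).getD ⟨0, by omega⟩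
    have hin : ∀ (k : ℕ+) (o : Option (Fin m)) (h : (k : ℕ) ∈ Finset.Icc 1 n),
        ω (chainRoot q k) (chainPos q k) o = w ⟨k, h⟩ := by
      intro k o h
      have e := chainRoot_mul_pow q k
      simp only [ω, e, h, dif_pos]
    have hdig : ∀ (k : ℕ+) (h : (k : ℕ) ∈ Finset.Icc 1 n),
        (chainPoint q ω).digit k = w ⟨k, h⟩ := by
      intro k h
      by_cases hd : q ∣ (k : ℕ)
      · have hk : (k : ℕ) = (⟨k / q, Nat.div_pos (Nat.le_of_dvd k.pos hd) (by omega)⟩ : ℕ+) * q :=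
          (Nat.div_mul_cancel hd).symm
        rw [chainPoint_digit_mul hq ω hk, hin k _ h]
      · rw [chainPoint_digit_of_not_dvd hq ω hd, hin k _ h]
    refine ⟨chainPoint q ω, fun k l hl => ?_, ?_⟩
    · rw [mul_comm] at hl
      by_cases h : (l : ℕ) ∈ Finset.Icc 1 n
      · have hk : (k : ℕ) ∈ Finset.Icc 1 n := by
          rw [Finset.mem_Icc] at h ⊢
          exact ⟨k.pos, (Nat.le_mul_of_pos_right _ (by omega)).trans (hl.symm.le.trans h.2)⟩
        rw [hdig k hk, hdig l h]
        exact hw _ _ hl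
      · have hl' : (chainPoint q ω).digit l = nxt ((chainPoint q ω).digit k) := by
          rw [chainPoint_digit_mul hq ω hl]
          have e := chainRoot_mul_pow q l
          simp only [ω, e, h, dif_neg, not_false_eq_true, Option.map_some, Option.getD_some]
        rw [hl']
        exact hnxt _
    · funext k
      exact hdig ⟨k, (Finset.mem_Icc.1 k.2).1⟩ k.2

end Chains

/-! ### Number of admissible prefixes. -/

section Counting

variable {m q : ℕ} {A : Matrix (Fin m) (Fin m) ℝ}

/-- The vector `v` is arbitrary so that the induction can absorb the first letter by passing to `v
ᵥ* A`. -/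
lemma sum_prod_entries (v : Fin m → ℝ) (k : ℕ) :
    ∑ z : Fin (k + 1) → Fin m, v (z 0) * ∏ j : Fin k, A (z j.castSucc) (z j.succ) =
      v ⬝ᵥ ((A ^ k) *ᵥ 1) := by
  induction k generalizing v with
  | zero =>
    rw [← (Equiv.funUnique (Fin 1) (Fin m)).symm.sum_comp]
    simp [dotProduct]
  | succ k ih =>
    rw [pow_succ', ← Matrix.mulVec_mulVec, Matrix.dotProduct_mulVec, ← ih,
      ← (Fin.consEquiv fun _ => Fin m).sum_comp, Fintype.sum_prod_type, Finset.sum_comm]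
    refine Finset.sum_congr rfl fun z _ => ?_
    rw [Matrix.vecMul, dotProduct, Finset.sum_mul]
    refine Finset.sum_congr rfl fun a _ => ?_
    rw [Fin.prod_univ_succ]
    simp [Fin.consEquiv, mul_assoc]

/-- The words of length `k + 1` all of whose transitions are allowed by `A`. -/
def chainWords (A : Matrix (Fin m) (Fin m) ℝ) (k : ℕ) : Set (Fin (k + 1) → Fin m) :=
  {z | ∀ j : Fin k, A (z j.castSucc) (z j.succ) = 1}

lemma card_chainWords (hA01 : ∀ i j, A i j = 0 ∨ A i j = 1) (k : ℕ) :
    (Nat.card (chainWords A k) : ℝ) = wordCount A k := by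
  classical
  rw [wordCount, dotProduct_comm, ← sum_prod_entries, Nat.card_eq_fintype_card,
    Fintype.card_subtype, Finset.card_filter, Nat.cast_sum]
  refine Finset.sum_congr rfl fun z _ => ?_
  rw [Pi.one_apply, one_mul]
  split_ifs with h
  · rw [Finset.prod_eq_one fun j _ => h j, Nat.cast_one]
  · have : ∃ j : Fin k, A (z j.castSucc) (z j.succ) ≠ 1 := not_forall.1 h
    obtain ⟨j, hj⟩ := this
    rw [Finset.prod_eq_zero (Finset.mem_univ j) ((hA01 _ _).resolve_right hj), Nat.cast_zero]

/-- The last `j` with `i q ^ j ≤ n`. -/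
def chainEnd (q n i : ℕ) : ℕ := Nat.log q (n / i)

lemma lt_chainEnd_add_one_iff (hq : 2 ≤ q) {n i j : ℕ} (hi : i ∈ nonmultiples q n) :
    j < chainEnd q n i + 1 ↔ i * q ^ j ≤ n := by
  have hi' := mem_nonmultiples.1 hi
  have hi0 : 0 < i := Nat.pos_of_ne_zero fun h => hi'.2 (by simp [h])
  have hdiv : n / i ≠ 0 := (Nat.div_pos hi'.1 hi0).ne'
  rw [Nat.lt_succ_iff, chainEnd, Nat.le_log_iff_pow_le (by omega) hdiv, Nat.le_div_iff_mul_le hi0,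
    mul_comm]

/-- The decomposition of `{1, …, n}` into geometric progressions of ratio `q`. -/
noncomputable def chainEquiv (hq : 2 ≤ q) (n : ℕ) :
    (Σ i : nonmultiples q n, Fin (chainEnd q n i + 1)) ≃ Finset.Icc 1 n :=
  Equiv.ofBijective
    (fun p => ⟨p.1 * q ^ (p.2 : ℕ), Finset.mem_Icc.2
      ⟨Nat.mul_pos (Nat.pos_of_ne_zero fun h => (mem_nonmultiples.1 p.1.2).2 (by simp [h]))
        (by positivity), (lt_chainEnd_add_one_iff hq p.1.2).1 p.2.2⟩⟩) <| by
    constructor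
    · rintro ⟨⟨i, hi⟩, ⟨j, hj⟩⟩ ⟨⟨i', hi'⟩, ⟨j', hj'⟩⟩ h
      have h : i * q ^ j = i' * q ^ j' := congrArg Subtype.val h
      have e := chainRoot_mul_pow_eq hq (mem_nonmultiples.1 hi).2 j
      have e' := chainPos_mul_pow hq (mem_nonmultiples.1 hi).2 j
      rw [h, chainRoot_mul_pow_eq hq (mem_nonmultiples.1 hi').2] at e
      rw [h, chainPos_mul_pow hq (mem_nonmultiples.1 hi').2] at e'
      subst e e'
      rfl
    · rintro ⟨k, hk⟩
      rw [Finset.mem_Icc] at hk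
      have e := chainRoot_mul_pow q k
      have hroot : chainRoot q k ∈ nonmultiples q n := mem_nonmultiples.2
        ⟨(Nat.div_le_self _ _).trans hk.2, not_dvd_chainRoot hq hk.1⟩
      exact ⟨⟨⟨chainRoot q k, hroot⟩,
        ⟨chainPos q k, (lt_chainEnd_add_one_iff hq hroot).2 (e.le.trans hk.2)⟩⟩, Subtype.ext e⟩

lemma chainEquiv_apply (hq : 2 ≤ q) (n : ℕ) (i : nonmultiples q n)
    (j : Fin (chainEnd q n i + 1)) : (chainEquiv hq n ⟨i, j⟩ : ℕ) = i * q ^ (j : ℕ) := rfl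

/-- Admissible words correspond to families of admissible words along the progressions. -/
noncomputable def admissibleWordsEquiv (hq : 2 ≤ q) (A : Matrix (Fin m) (Fin m) ℝ) (n : ℕ) :
    admissibleWords q A n ≃ ∀ i : nonmultiples q n, chainWords A (chainEnd q n i) :=
  (Equiv.subtypeEquiv (q := fun f : ∀ i : nonmultiples q n, Fin (chainEnd q n i + 1) → Fin m =>
      ∀ i : nonmultiples q n, f i ∈ chainWords A (chainEnd q n i))
    ((Equiv.arrowCongr (chainEquiv hq n).symm (Equiv.refl (Fin m))).trans
      (Equiv.piCurry fun (i : nonmultiples q n) (_ : Fin (chainEnd q n i + 1)) => Fin m)) <| by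
    intro w
    constructor
    · intro hw i j
      exact hw (chainEquiv hq n ⟨i, j.castSucc⟩) (chainEquiv hq n ⟨i, j.succ⟩) (by
        simp [chainEquiv_apply, pow_succ, mul_assoc])
    · intro hw k l hl
      obtain ⟨⟨i, j⟩, rfl⟩ := (chainEquiv hq n).surjective k
      rw [chainEquiv_apply, mul_assoc, ← pow_succ] at hl
      have hj : (j : ℕ) + 1 < chainEnd q n i + 1 :=
        (lt_chainEnd_add_one_iff hq i.2).2 (hl ▸ (Finset.mem_Icc.1 l.2).2)
      have hl' : l = chainEquiv hq n ⟨i, (⟨j, by omega⟩ : Fin (chainEnd q n i)).succ⟩ :=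
        Subtype.ext hl
      rw [hl']
      exact hw i ⟨j, by omega⟩).trans
  Equiv.subtypePiEquivPi

lemma card_admissibleWords (hq : 2 ≤ q) (hA01 : ∀ i j, A i j = 0 ∨ A i j = 1) (n : ℕ) :
    (Nat.card (admissibleWords q A n) : ℝ) =
      ∏ i ∈ nonmultiples q n, wordCount A (chainEnd q n i) := by
  rw [Nat.card_congr (admissibleWordsEquiv hq A n), Nat.card_pi, Nat.cast_prod]
  simp only [card_chainWords hA01]
  exact Finset.prod_coe_sort (nonmultiples q n) fun i => wordCount A (chainEnd q n i)

/-- Summation by parts: each `log N_e` is telescoped over the positions of its progression, and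
after exchanging sums the level `j` is counted once for each root `i` with `i q^j ≤ n`. -/
lemma log_card_admissibleWords (hm : 2 ≤ m) (hq : 2 ≤ q)
    (hA01 : ∀ i j, A i j = 0 ∨ A i j = 1) (hA : A.IsPrimitive) {a : ℕ → ℝ} (ha0 : a 0 = 0)
    (ha : ∀ k, a (k + 1) = Real.log (wordCount A k)) (n : ℕ) :
    Real.log (Nat.card (admissibleWords q A n)) =
      ∑ j ∈ Finset.range n, (a (j + 1) - a j) * (nonmultiples q (n / q ^ j)).card := by
  rw [card_admissibleWords hq hA01, Real.log_prod fun i _ =>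
    (zero_lt_one.trans_le (one_le_wordCount hm hA01 hA _)).ne']
  have h : ∀ e, Real.log (wordCount A e) = ∑ j ∈ Finset.range (e + 1), (a (j + 1) - a j) := by
    intro e
    rw [Finset.sum_range_sub, ha, ha0, sub_zero]
  simp_rw [h]
  rw [Finset.sum_comm' (t' := Finset.range n) (s' := fun j => nonmultiples q (n / q ^ j))]
  · simp only [Finset.sum_const, nsmul_eq_mul, mul_comm]
  · intro i j
    rw [Finset.mem_range, Finset.mem_range, mem_nonmultiples (n := n / q ^ j)]
    constructor
    · rintro ⟨hi, hj⟩
      have hle := (lt_chainEnd_add_one_iff hq hi).1 hj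
      refine ⟨⟨(Nat.le_div_iff_mul_le (by positivity)).2 hle, (mem_nonmultiples.1 hi).2⟩, ?_⟩
      have hi0 : 0 < i := Nat.pos_of_ne_zero fun h => (mem_nonmultiples.1 hi).2 (by simp [h])
      exact (Nat.lt_pow_self (by omega)).trans_le ((Nat.le_mul_of_pos_left _ hi0).trans hle)
    · rintro ⟨⟨hi, hnd⟩, -⟩
      have hi' : i ∈ nonmultiples q n := mem_nonmultiples.2 ⟨hi.trans (Nat.div_le_self _ _), hnd⟩
      exact ⟨hi', (lt_chainEnd_add_one_iff hq hi').2
        ((Nat.le_div_iff_mul_le (by positivity)).1 hi)⟩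

theorem tendsto_log_card_admissibleWords_div (hm : 2 ≤ m) (hq : 2 ≤ q)
    (hA01 : ∀ i j, A i j = 0 ∨ A i j = 1) (hA : A.IsPrimitive) :
    Tendsto (fun n : ℕ => Real.log (Nat.card (admissibleWords q A n)) / n) atTop
      (𝓝 ((1 - 1 / q) ^ 2 * ∑' k : ℕ, Real.log (wordCount A k) / (q : ℝ) ^ k)) := by
  have hq0 : (0 : ℝ) < q := by positivity
  let a : ℕ → ℝ := fun k => Nat.casesOn k 0 fun k => Real.log (wordCount A k)
  have hbound : ∀ j, |a (j + 1) - a j| ≤ (j + 1) * Real.log m := by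
    have hnn : ∀ j, 0 ≤ a j := by
      rintro (_ | j)
      · exact le_rfl
      · exact log_wordCount_nonneg hm hA01 hA j
    have hle : ∀ j, a j ≤ j * Real.log m := by
      rintro (_ | j)
      · simp [a]
      · exact_mod_cast log_wordCount_le hm hA01 hA j
    have hlog : 0 ≤ Real.log m := Real.log_natCast_nonneg m
    intro j
    have h1 := hle (j + 1)
    have h2 := hle j
    have h3 := hnn (j + 1)
    have h4 := hnn j
    push_cast at h1
    exact abs_le.2 ⟨by linarith, by linarith⟩
  have hV := tendsto_sum_chains_div hq
    (V := fun j N => (a (j + 1) - a j) * (nonmultiples q N).card)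
    (c := fun j => (a (j + 1) - a j) * (1 - 1 / q)) (C := fun j => ((j : ℝ) + 1) * Real.log m)
    (fun j => ?_) (fun j N => ?_) ?_
  · have hsum := summable_log_wordCount hm hq hA01 hA
    have hsum' : Summable fun k => a k / (q : ℝ) ^ k := by
      refine (summable_nat_add_iff 1).1 ((hsum.div_const (q : ℝ)).congr fun k => ?_)
      rw [pow_succ, div_div]
    have hshift : ∑' k, a k / (q : ℝ) ^ k =
        (∑' k, Real.log (wordCount A k) / (q : ℝ) ^ k) / q := by
      have h0 : a 0 / (q : ℝ) ^ 0 = 0 := zero_div _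
      rw [hsum'.tsum_eq_zero_add, ← tsum_div_const, h0, zero_add]
      exact tsum_congr fun k => by rw [pow_succ, div_div]
    -- One factor `1 - 1/q` is the density of non-multiples of `q`; the other comes from subtracting
    -- the series shifted by one index.
    have hval : ∑' j, (a (j + 1) - a j) * (1 - 1 / q) / (q : ℝ) ^ j =
        (1 - 1 / q) ^ 2 * ∑' k : ℕ, Real.log (wordCount A k) / (q : ℝ) ^ k := by
      have : ∀ j, (a (j + 1) - a j) * (1 - 1 / q) / (q : ℝ) ^ j =
          (1 - 1 / q) * (Real.log (wordCount A j) / (q : ℝ) ^ j - a j / (q : ℝ) ^ j) :=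
        fun j => by simp only [a]; ring
      rw [tsum_congr this, tsum_mul_left, hsum.tsum_sub hsum', hshift]
      ring
    rw [← hval]
    refine hV.congr fun n => ?_
    rw [log_card_admissibleWords hm hq hA01 hA (a := a) rfl fun _ => rfl]
  · have h : Tendsto (fun N : ℕ => 1 - ((N / q : ℕ) : ℝ) / N) atTop (𝓝 (1 - 1 / q)) :=
      tendsto_const_nhds.sub (tendsto_natDiv_div (by omega))
    refine (h.const_mul (a (j + 1) - a j)).congr' ?_
    filter_upwards [eventually_gt_atTop 0] with N hN
    have hN' : (0 : ℝ) < N := by exact_mod_cast hN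
    rw [card_nonmultiples hq]
    field_simp
  · rw [abs_mul, Nat.abs_cast]
    refine mul_le_mul (hbound j) ?_ (Nat.cast_nonneg _) (by
      exact mul_nonneg (by positivity) (Real.log_natCast_nonneg m))
    rw [card_nonmultiples hq]
    simp
  · exact ((summable_add_one_div_pow hq).mul_right (Real.log m)).congr fun j => by ring

end Counting

/-! ### Covering numbers and the Minkowski dimension. -/

section Minkowski

variable {m q : ℕ} {A : Matrix (Fin m) (Fin m) ℝ}

lemma coveringNumber_eq_encard_image_prefixWord (hm : 2 ≤ m) (S : Set (SeqSpace m)) {n : ℕ}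
    {r : ℝ≥0} (hr : ((m : ℝ) ^ n)⁻¹ ≤ r) (hr' : (r : ℝ) < ((m : ℝ) ^ n)⁻¹ * m) :
    Metric.coveringNumber r S = (prefixWord n '' S).encard := by
  have hball : ∀ x y : SeqSpace m, edist x y ≤ r ↔ prefixWord n x = prefixWord n y := by
    intro x y
    rw [prefixWord_eq_iff, ← SeqSpace.dist_le_iff hm hr hr', edist_dist,
      ENNReal.ofReal_le_iff_le_toReal ENNReal.coe_ne_top, ENNReal.coe_toReal]
  apply le_antisymm
  · obtain ⟨C, hCS, hC⟩ := (Set.surjOn_image (prefixWord n) S).exists_bijOn_subset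
    refine (Metric.IsCover.coveringNumber_le_encard hCS fun x hx => ?_).trans ?_
    · obtain ⟨y, hy, hxy⟩ := hC.surjOn (Set.mem_image_of_mem _ hx)
      exact ⟨y, hy, (hball x y).2 hxy.symm⟩
    · rw [← hC.image_eq, hC.injOn.encard_image]
  · refine le_iInf₂ fun C hCS => le_iInf fun hC => ?_
    refine (Set.encard_le_encard ?_).trans (Set.encard_image_le (prefixWord n) C)
    rintro _ ⟨x, hx, rfl⟩
    obtain ⟨y, hy, hxy⟩ := hC hx
    exact ⟨y, hy, ((hball x y).1 hxy).symm⟩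

lemma eventually_boxRatio_multShift (hm : 2 ≤ m) (hq : 2 ≤ q)
    (hA01 : ∀ i j, A i j = 0 ∨ A i j = 1) (hA : A.IsPrimitive) :
    ∀ᶠ r : ℝ≥0 in 𝓝[>] 0, boxRatio (multShift q A) r =
      ((Real.log (Nat.card (admissibleWords q A ⌈Real.logb m (1 / (r : ℝ))⌉₊)) /
        Real.log (1 / (r : ℝ)) : ℝ) : EReal) := by
  have hm1 : (1 : ℝ) < m := by exact_mod_cast (by omega : 1 < m)
  have hm0 : (0 : ℝ) < m := by positivity
  filter_upwards [Ioo_mem_nhdsGT (zero_lt_one' ℝ≥0)] with r hr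
  have hr0 : (0 : ℝ) < r := by exact_mod_cast hr.1
  have hr1 : (r : ℝ) < 1 := by exact_mod_cast hr.2
  set y := Real.logb m (1 / (r : ℝ)) with hy
  have hy0 : 0 < y := Real.logb_pos hm1 (by rwa [lt_div_iff₀ hr0, one_mul])
  have hry : (r : ℝ) = ((m : ℝ) ^ y)⁻¹ := by
    rw [hy, Real.rpow_logb hm0 hm1.ne' (by positivity), one_div, inv_inv]
  have h1 : ((m : ℝ) ^ ⌈y⌉₊)⁻¹ ≤ r := by
    rw [hry]
    gcongr
    rw [← Real.rpow_natCast]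
    exact Real.rpow_le_rpow_of_exponent_le hm1.le (Nat.le_ceil y)
  -- With `n = ⌈log_m (1/r)⌉` the radius satisfies `m^(-n) ≤ r < m^(1-n)`, so balls of radius `r`
  -- are cylinders of length `n`.
  have h2 : (r : ℝ) < ((m : ℝ) ^ ⌈y⌉₊)⁻¹ * m := by
    rw [hry, inv_mul_eq_div, lt_div_iff₀ (by positivity), inv_mul_lt_iff₀ (by positivity),
      ← Real.rpow_add_one hm0.ne', ← Real.rpow_natCast]
    exact Real.rpow_lt_rpow_of_exponent_lt hm1 (Nat.ceil_lt_add_one hy0.le)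
  have hcard : (Nat.card (admissibleWords q A ⌈y⌉₊) : ℝ) ≠ 0 := by
    rw [card_admissibleWords hq hA01]
    exact Finset.prod_ne_zero_iff.2 fun i _ =>
      (zero_lt_one.trans_le (one_le_wordCount hm hA01 hA _)).ne'
  have hcov : ((Metric.coveringNumber r (multShift q A) : ℕ∞) : ℝ≥0∞) =
      ((Nat.card (admissibleWords q A ⌈y⌉₊) : ℝ≥0) : ℝ≥0∞) := by
    rw [coveringNumber_eq_encard_image_prefixWord hm _ h1 h2,
      prefixWord_image_multShift hm hq hA01 hA, ← (Set.toFinite _).cast_ncard_eq]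
    rw [Nat.card_coe_set_eq, ENat.toENNReal_coe, ENNReal.coe_natCast]
  rw [boxRatio, hcov, ENNReal.log_of_nnreal (by exact_mod_cast hcard), EReal.coe_div]
  simp

theorem hasMinkowskiDim_multShift (hm : 2 ≤ m) (hq : 2 ≤ q)
    (hA01 : ∀ i j, A i j = 0 ∨ A i j = 1) (hA : A.IsPrimitive) :
    HasMinkowskiDim (multShift q A)
      (((1 - 1 / q) ^ 2 * (∑' k : ℕ, Real.log (wordCount A k) / (q : ℝ) ^ k) /
        Real.log m : ℝ) : EReal) := by
  have hm1 : (1 : ℝ) < m := by exact_mod_cast (by omega : 1 < m)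
  have hlog : 0 < Real.log m := Real.log_pos hm1
  suffices h : Tendsto (boxRatio (multShift q A)) (𝓝[>] 0)
      (𝓝 (((1 - 1 / q) ^ 2 * (∑' k : ℕ, Real.log (wordCount A k) / (q : ℝ) ^ k) /
        Real.log m : ℝ) : EReal)) from ⟨h.liminf_eq, h.limsup_eq⟩
  refine Tendsto.congr' (EventuallyEq.symm (eventually_boxRatio_multShift hm hq hA01 hA)) ?_
  refine (continuous_coe_real_ereal.tendsto _).comp ?_
  have hr : Tendsto (fun r : ℝ≥0 => (r : ℝ)) (𝓝[>] 0) (𝓝[>] 0) := by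
    refine tendsto_nhdsWithin_iff.2 ⟨?_, ?_⟩
    · exact (NNReal.continuous_coe.tendsto' 0 0 rfl).mono_left nhdsWithin_le_nhds
    · filter_upwards [self_mem_nhdsWithin] with r hr
      exact NNReal.coe_pos.2 hr
  have hlogr : Tendsto (fun r : ℝ≥0 => Real.log (1 / (r : ℝ))) (𝓝[>] 0) atTop := by
    simp only [one_div]
    exact Real.tendsto_log_atTop.comp (tendsto_inv_nhdsGT_zero.comp hr)
  have hy : Tendsto (fun r : ℝ≥0 => Real.logb m (1 / (r : ℝ))) (𝓝[>] 0) atTop := by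
    simp only [Real.logb]
    exact hlogr.atTop_div_const hlog
  have hceil := (tendsto_nat_ceil_div_atTop (R := ℝ)).comp hy
  have hn := (tendsto_log_card_admissibleWords_div hm hq hA01 hA).comp
    (tendsto_nat_ceil_atTop.comp hy)
  have := (hn.mul hceil).div_const (Real.log m)
  rw [mul_one] at this
  refine this.congr' ?_
  filter_upwards [hy.eventually_gt_atTop 0] with r hr0
  have hc : ((⌈Real.logb m (1 / (r : ℝ))⌉₊ : ℕ) : ℝ) ≠ 0 := by
    exact_mod_cast (Nat.ceil_pos.2 hr0).ne'
  simp only [Function.comp_apply]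
  rw [div_mul_div_cancel₀ hc, div_div, Real.logb, div_mul_cancel₀ _ hlog.ne']

end Minkowski

/-! ### Independent Markov chains on the progressions. -/

section RandomChains

open MeasureTheory ProbabilityTheory

variable {m q : ℕ}

/-- The term `x_k`, for a natural number `k ≥ 1`. -/
def SeqSpace.letter (x : SeqSpace m) (k : ℕ) : Fin m := x.digit k.toPNat'

lemma SeqSpace.letter_coe (x : SeqSpace m) (k : ℕ+) : x.letter k = x.digit k := by
  simp [SeqSpace.letter]

lemma SeqSpace.letter_eq_digit (x : SeqSpace m) {k : ℕ} (hk : 0 < k) :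
    x.letter k = x.digit ⟨k, hk⟩ :=
  x.letter_coe ⟨k, hk⟩

lemma prefixWord_eq_iff_letter {n : ℕ} {x y : SeqSpace m} :
    prefixWord n x = prefixWord n y ↔ ∀ k ∈ Finset.Icc 1 n, x.letter k = y.letter k := by
  rw [prefixWord_eq_iff]
  constructor
  · intro h k hk
    rw [Finset.mem_Icc] at hk
    rw [x.letter_eq_digit hk.1, y.letter_eq_digit hk.1]
    exact h ⟨k, hk.1⟩ hk.2
  · intro h k hk
    rw [← SeqSpace.letter_coe, ← SeqSpace.letter_coe]
    exact h k (Finset.mem_Icc.2 ⟨k.pos, hk⟩)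

/-- The letter `x_{k/q}` if `q` divides `k`. -/
def parentLetter (q : ℕ) (x : SeqSpace m) (k : ℕ) : Option (Fin m) :=
  if q ∣ k then some (x.letter (k / q)) else none

lemma chainPoint_letter (hq : 2 ≤ q) (ω : ℕ → ℕ → Option (Fin m) → Fin m) {k : ℕ} (hk : 1 ≤ k) :
    (chainPoint q ω).letter k =
      ω (chainRoot q k) (chainPos q k) (parentLetter q (chainPoint q ω) k) := by
  lift k to ℕ+ using hk
  rw [SeqSpace.letter_coe, parentLetter]
  split_ifs with hd
  · have hpos : 0 < (k : ℕ) / q := Nat.div_pos (Nat.le_of_dvd k.pos hd) (by omega)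
    have hk : (k : ℕ) = (⟨k / q, hpos⟩ : ℕ+) * q := (Nat.div_mul_cancel hd).symm
    rw [chainPoint_digit_mul hq ω hk, SeqSpace.letter_eq_digit _ hpos]
  · rw [chainPoint_digit_of_not_dvd hq ω hd]

/-- The law of a sequence of independent update rules, whose values at `o` have law `p o`. -/
noncomputable def ruleMeasure (p : Option (Fin m) → PMF (Fin m)) :
    Measure (ℕ → Option (Fin m) → Fin m) :=
  Measure.infinitePi fun _ => Measure.pi fun o => (p o).toMeasure

instance (p : Option (Fin m) → PMF (Fin m)) : IsProbabilityMeasure (ruleMeasure p) := by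
  unfold ruleMeasure; infer_instance

/-- The law of independent sequences of update rules. -/
noncomputable def chainMeasure (p : Option (Fin m) → PMF (Fin m)) :
    Measure (ℕ → ℕ → Option (Fin m) → Fin m) :=
  Measure.infinitePi fun _ => ruleMeasure p

instance (p : Option (Fin m) → PMF (Fin m)) : IsProbabilityMeasure (chainMeasure p) := by
  unfold chainMeasure; infer_instance

/-- Each rule may be evaluated at the parent letter of the fixed point `x` instead of the random
one, by strong induction since `k / q < k`. The cylinder thus becomes a condition on separate
independent coordinates. -/
lemma prefixWord_chainPoint_eq_iff (hq : 2 ≤ q) (ω : ℕ → ℕ → Option (Fin m) → Fin m) (n : ℕ)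
    (x : SeqSpace m) :
    prefixWord n (chainPoint q ω) = prefixWord n x ↔
      ∀ k ∈ Finset.Icc 1 n, ω (chainRoot q k) (chainPos q k) (parentLetter q x k) = x.letter k := by
  have hpar : ∀ k ∈ Finset.Icc 1 n,
      (∀ l ∈ Finset.Icc 1 n, l < k → (chainPoint q ω).letter l = x.letter l) →
      parentLetter q (chainPoint q ω) k = parentLetter q x k := by
    intro k hk h
    rw [Finset.mem_Icc] at hk
    unfold parentLetter
    split_ifs with hd
    · rw [h]
      · exact Finset.mem_Icc.2 ⟨Nat.div_pos (Nat.le_of_dvd hk.1 hd) (by omega),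
          (Nat.div_le_self _ _).trans hk.2⟩
      · exact Nat.div_lt_self hk.1 (by omega)
    · rfl
  rw [prefixWord_eq_iff_letter]
  constructor
  · intro h k hk
    rw [← h k hk, chainPoint_letter hq ω (Finset.mem_Icc.1 hk).1, hpar k hk fun l hl _ => h l hl]
  · intro h k
    induction k using Nat.strong_induction_on with
    | _ k ih =>
      intro hk
      rw [← h k hk, chainPoint_letter hq ω (Finset.mem_Icc.1 hk).1,
        hpar k hk fun l hl hlk => ih l hlk hl]

lemma chainMeasure_prefixWord (hq : 2 ≤ q) (p : Option (Fin m) → PMF (Fin m)) (n : ℕ)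
    (x : SeqSpace m) :
    chainMeasure p {ω | prefixWord n (chainPoint q ω) = prefixWord n x} =
      ∏ k ∈ Finset.Icc 1 n, p (parentLetter q x k) (x.letter k) := by
  let B : ℕ × ℕ → Set (Option (Fin m) → Fin m) := fun r =>
    Function.eval (parentLetter q x (r.1 * q ^ r.2)) ⁻¹' {x.letter (r.1 * q ^ r.2)}
  have hB : ∀ r, MeasurableSet (B r) := fun r =>
    measurable_pi_apply _ (measurableSet_singleton _)
  let c : ℕ → ℕ × ℕ := fun k => (chainRoot q k, chainPos q k)
  have hc : ∀ k, (c k).1 * q ^ (c k).2 = k := fun k => chainRoot_mul_pow q k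
  have hinj : Function.Injective c := fun k l h => by rw [← hc k, ← hc l, h]
  have hset : {ω | prefixWord n (chainPoint q ω) = prefixWord n x} =
      (MeasurableEquiv.curry ℕ ℕ (Option (Fin m) → Fin m)).symm ⁻¹'
        Set.pi ((Finset.Icc 1 n).image c) B := by
    ext ω
    rw [Set.mem_ofPred_eq, prefixWord_chainPoint_eq_iff hq, Set.mem_preimage, Set.mem_pi]
    simp only [Finset.mem_coe, Finset.mem_image, forall_exists_index, and_imp,
      forall_apply_eq_imp_iff₂]
    refine forall₂_congr fun k _ => ?_
    simp only [B, hc, Set.mem_preimage, Set.mem_singleton_iff]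
    rfl
  rw [hset, ← Measure.map_apply (MeasurableEquiv.measurable _)
    (MeasurableSet.pi (Finset.countable_toSet _) fun r _ => hB r), chainMeasure]
  unfold ruleMeasure
  rw [Measure.infinitePi_map_curry_symm, Measure.infinitePi_pi _ fun r _ => hB r,
    Finset.prod_image hinj.injOn]
  refine Finset.prod_congr rfl fun k _ => ?_
  simp only [B, hc]
  rw [(measurePreserving_eval _ _).measure_preimage (measurableSet_singleton _).nullMeasurableSet,
    PMF.toMeasure_apply_singleton _ _ (measurableSet_singleton _)]

lemma measurable_chainSeq (j : ℕ) :
    Measurable fun U : ℕ → Option (Fin m) → Fin m => chainSeq U j := by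
  induction j with
  | zero => exact (measurable_pi_apply none).comp (measurable_pi_apply 0)
  | succ j ih =>
    refine measurable_to_countable' fun b => ?_
    have : (fun U : ℕ → Option (Fin m) → Fin m => chainSeq U (j + 1)) ⁻¹' {b} =
        ⋃ a : Fin m, (fun U => chainSeq U j) ⁻¹' {a} ∩ (fun U => U (j + 1) (some a)) ⁻¹' {b} := by
      ext U
      simp [chainSeq]
    rw [this]
    exact MeasurableSet.iUnion fun a => (ih (measurableSet_singleton a)).inter
      (((measurable_pi_apply (some a)).comp (measurable_pi_apply (j + 1)))
        (measurableSet_singleton b))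

lemma measurable_prefixWord_chainPoint (n : ℕ) :
    Measurable fun ω : ℕ → ℕ → Option (Fin m) → Fin m => prefixWord n (chainPoint q ω) :=
  measurable_pi_iff.2 fun _ => (measurable_chainSeq _).comp (measurable_pi_apply _)

lemma ae_chainMeasure_apply_ne_zero (p : Option (Fin m) → PMF (Fin m)) :
    ∀ᵐ ω ∂chainMeasure p, ∀ i j o, p o (ω i j o) ≠ 0 := by
  simp only [ae_all_iff]
  intro i j o
  have h1 := measurePreserving_eval_infinitePi (fun _ : ℕ => ruleMeasure p) i
  have h2 := measurePreserving_eval_infinitePi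
    (fun _ : ℕ => Measure.pi fun o => (p o).toMeasure) j
  have h3 := measurePreserving_eval (fun o => (p o).toMeasure) o
  have hmp := (h3.comp h2).comp h1
  have h0 : ∀ᵐ a ∂(p o).toMeasure, p o a ≠ 0 := by
    rw [ae_iff_of_countable]
    intro a ha
    rwa [PMF.toMeasure_apply_singleton _ _ (measurableSet_singleton _)] at ha
  exact hmp.quasiMeasurePreserving.ae h0

/-- The strong law of large numbers along an injection, for functions of independent variables
with a common law. -/
lemma ae_tendsto_average_comp {Ω E : Type*} [MeasurableSpace Ω] [MeasurableSpace E]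
    {P : Measure Ω} {ν : Measure E}
    [IsProbabilityMeasure P] {Y : ℕ → Ω → E} (hY : ∀ i, MeasurePreserving (Y i) P ν)
    (hind : iIndepFun Y P) {g : E → ℝ} (hg : Measurable g) {C : ℝ} (hC : ∀ x, |g x| ≤ C)
    {φ : ℕ → ℕ} (hφ : Function.Injective φ) :
    ∀ᵐ ω ∂P, Tendsto (fun N : ℕ => (∑ i ∈ Finset.range N, g (Y (φ i) ω)) / N) atTop
      (𝓝 (∫ x, g x ∂ν)) := by
  have hmeas : ∀ i, Measurable fun ω => g (Y i ω) := fun i => hg.comp (hY i).measurable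
  have hmean : ∫ x, g x ∂ν = ∫ ω, g (Y (φ 0) ω) ∂P := by
    rw [← (hY (φ 0)).map_eq, integral_map (hY (φ 0)).measurable.aemeasurable
      hg.aestronglyMeasurable]
  rw [hmean]
  refine strong_law_ae_real (fun i ω => g (Y (φ i) ω)) ?_ ?_ ?_
  · exact Integrable.of_bound (hmeas _).aestronglyMeasurable C (ae_of_all _ fun ω => hC _)
  · exact fun i i' h => (hind.indepFun (hφ.ne h)).comp hg hg
  · intro i
    refine ⟨(hmeas _).aemeasurable, (hmeas _).aemeasurable, ?_⟩
    have h := fun i => Measure.map_map (μ := P) hg (hY i).measurable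
    simp only [(hY _).map_eq] at h
    exact (h (φ i)).symm.trans (h (φ 0))

/-- The sum of `f` over the first `n` terms of `x`. -/
noncomputable def letterSum (f : Fin m → ℝ) (x : SeqSpace m) (n : ℕ) : ℝ :=
  ∑ k ∈ Finset.Icc 1 n, f (x.letter k)

/-- For fixed `j` the letters at position `j` of the different progressions are independent and
identically distributed, so the strong law applies on each level. Only the existence of the limit
matters later, since its value cancels. -/
lemma ae_exists_tendsto_letterSum_div (hq : 2 ≤ q) (p : Option (Fin m) → PMF (Fin m))
    (f : Fin m → ℝ) :
    ∀ᵐ ω ∂chainMeasure p, ∃ L : ℝ,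
      Tendsto (fun n : ℕ => letterSum f (chainPoint q ω) n / n) atTop (𝓝 L) := by
  have hinj1 : Function.Injective fun i : ℕ => i + 1 := fun _ _ h => by simpa using h
  have hinj2 : Function.Injective fun i : ℕ => (i + 1) * q := fun a b h => by
    have := Nat.eq_of_mul_eq_mul_right (by omega : 0 < q) h
    omega
  let C : ℝ := ∑ a, |f a|
  have hC : ∀ a, |f a| ≤ C := fun a =>
    Finset.single_le_sum (f := fun a => |f a|) (fun a _ => abs_nonneg _) (Finset.mem_univ a)
  have hg : ∀ j, Measurable fun U : ℕ → Option (Fin m) → Fin m => f (chainSeq U j) :=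
    fun j => (measurable_of_countable f).comp (measurable_chainSeq j)
  have hmp : ∀ i, MeasurePreserving (fun ω : ℕ → ℕ → Option (Fin m) → Fin m => ω i)
      (chainMeasure p) (ruleMeasure p) := fun i => measurePreserving_eval_infinitePi _ i
  have hind : iIndepFun (fun (i : ℕ) (ω : ℕ → ℕ → Option (Fin m) → Fin m) => ω i)
      (chainMeasure p) :=
    iIndepFun_infinitePi (P := fun _ : ℕ => ruleMeasure p) (X := fun _ x => x) fun _ => measurable_id
  have h1 := ae_all_iff.2 fun j =>
    ae_tendsto_average_comp hmp hind (hg j) (fun _ => hC _) hinj1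
  have h2 := ae_all_iff.2 fun j =>
    ae_tendsto_average_comp hmp hind (hg j) (fun _ => hC _) hinj2
  filter_upwards [h1, h2] with ω h1 h2
  have hshift : ∀ (F : ℕ → ℝ) (N : ℕ),
      ∑ i ∈ Finset.range N, F (i + 1) = ∑ i ∈ Finset.Icc 1 N, F i := by
    intro F N
    rw [Finset.range_eq_Ico, Finset.sum_Ico_add' F 0 N 1]
    rfl
  set e : ℕ → ℝ := fun j => ∫ U, f (chainSeq U j) ∂ruleMeasure p
  let V : ℕ → ℕ → ℝ := fun j N => ∑ i ∈ nonmultiples q N, f (chainSeq (ω i) j)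
  refine ⟨∑' j, (1 - 1 / q) * e j / (q : ℝ) ^ j, ?_⟩
  have hlim := tendsto_sum_chains_div hq (V := V) (c := fun j => (1 - 1 / q) * e j)
    (C := fun _ => C) (fun j => ?_) (fun j N => ?_) ?_
  · refine hlim.congr fun n => ?_
    rw [letterSum, sum_Icc_eq_sum_chains hq]
    congr 1
    refine Finset.sum_congr rfl fun j _ => Finset.sum_congr rfl fun i hi => ?_
    have hi' := (mem_nonmultiples.1 hi).2
    have hi0 : 0 < i := Nat.pos_of_ne_zero fun h => hi' (by simp [h])
    have hpos : 0 < i * q ^ j := Nat.mul_pos hi0 (by positivity)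
    rw [SeqSpace.letter, chainPoint]
    simp only [Nat.toPNat'_coe, hpos, if_true, chainRoot_mul_pow_eq hq hi', chainPos_mul_pow hq hi']
  -- Averages over non-multiples of `q` are obtained as averages over all indices minus those over
  -- multiples of `q`.
  · have hsub := (h1 j).sub (((h2 j).comp (tendsto_natDiv_atTop (d := q) (by omega))).mul
      (tendsto_natDiv_div (d := q) (by omega)))
    have : e j - e j * (1 / q) = (1 - 1 / q) * e j := by ring
    rw [this] at hsub
    refine hsub.congr fun N => ?_
    have hsplit := sum_Icc_eq_nonmultiples_add hq N fun i => f (chainSeq (ω i) j)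
    rw [← hshift, ← hshift (fun i => f (chainSeq (ω (i * q)) j))] at hsplit
    simp only [V, Function.comp_apply]
    rw [hsplit]
    by_cases h0 : ((N / q : ℕ) : ℝ) = 0
    · have : N / q = 0 := by exact_mod_cast h0
      simp [this]
    · field_simp
      ring
  · calc |V j N| ≤ ∑ i ∈ nonmultiples q N, |f (chainSeq (ω i) j)| := Finset.abs_sum_le_sum_abs _ _
      _ ≤ ∑ i ∈ nonmultiples q N, C := Finset.sum_le_sum fun i _ => hC _
      _ = C * (nonmultiples q N).card := by rw [Finset.sum_const, nsmul_eq_mul, mul_comm]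
      _ ≤ C * N := by
        refine mul_le_mul_of_nonneg_left ?_ (Finset.sum_nonneg fun _ _ => abs_nonneg _)
        rw [card_nonmultiples hq]
        simp
  · have hr : ‖(1 / q : ℝ)‖ < 1 := by
      rw [Real.norm_of_nonneg (by positivity), div_lt_one (by positivity)]
      exact_mod_cast (by omega : 1 < q)
    refine ((summable_geometric_of_norm_lt_one hr).mul_left C).congr fun j => ?_
    rw [one_div, inv_pow]
    rfl

end RandomChains

/-! ### Mass distribution principle on cylinders. -/

section Scales

open MeasureTheory

variable {m : ℕ}

lemma inv_natCast_pow_rpow (hm : 2 ≤ m) (n : ℕ) (d : ℝ) :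
    (((m : ℝ≥0∞)⁻¹) ^ n) ^ d = ENNReal.ofReal (Real.exp (-(n * (d * Real.log m)))) := by
  have hm0 : (0 : ℝ) < m := by positivity
  have h : ((m : ℝ≥0∞)⁻¹) ^ n = ENNReal.ofReal (((m : ℝ) ^ n)⁻¹) := by
    rw [ENNReal.ofReal_inv_of_pos (by positivity), ENNReal.ofReal_pow hm0.le, ENNReal.ofReal_natCast,
      ENNReal.inv_pow]
  rw [h, ENNReal.ofReal_rpow_of_pos (by positivity)]
  congr 1
  rw [Real.rpow_def_of_pos (by positivity), Real.log_inv, Real.log_pow]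
  ring_nf

lemma edist_le_inv_pow_iff (hm : 2 ≤ m) {n : ℕ} {x y : SeqSpace m} :
    edist x y ≤ ((m : ℝ≥0∞)⁻¹) ^ n ↔ prefixWord n x = prefixWord n y := by
  have h : ((m : ℝ≥0∞)⁻¹) ^ n = ENNReal.ofReal (((m : ℝ) ^ n)⁻¹) := by
    rw [ENNReal.ofReal_inv_of_pos (by positivity), ENNReal.ofReal_pow (Nat.cast_nonneg _),
      ENNReal.ofReal_natCast, ENNReal.inv_pow]
  rw [h, edist_dist, ENNReal.ofReal_le_ofReal_iff (by positivity), SeqSpace.dist_le_inv_pow_iff hm,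
    prefixWord_eq_iff]

lemma tendsto_inv_natCast_pow (hm : 2 ≤ m) :
    Tendsto (fun n : ℕ => ((m : ℝ≥0∞)⁻¹) ^ n) atTop (𝓝 0) := by
  refine ENNReal.tendsto_pow_atTop_nhds_zero_of_lt_one ?_
  rw [ENNReal.inv_lt_one]
  exact_mod_cast (by omega : 1 < m)

/-- The mass distribution principle for sequence spaces. -/
lemma hausdorffMeasure_ne_zero_of_measure_cylinder_le [MeasurableSpace (SeqSpace m)]
    [BorelSpace (SeqSpace m)] (hm : 2 ≤ m) {Ω : Type*} [MeasurableSpace Ω] {P : Measure Ω}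
    {X : Ω → SeqSpace m} {S : Set (SeqSpace m)} {G : Set Ω} (hG : P G ≠ 0)
    (hGS : Set.MapsTo X G S) {d : ℝ} (hd : 0 < d) {N : ℕ}
    (hcyl : ∀ ω ∈ G, ∀ n ≥ N, P {ω' | prefixWord n (X ω') = prefixWord n (X ω)} ≤
      (((m : ℝ≥0∞)⁻¹) ^ n) ^ d) :
    Measure.hausdorffMeasure d S ≠ 0 := by
  set ρ : ℕ → ℝ≥0∞ := fun n => ((m : ℝ≥0∞)⁻¹) ^ n with hρ
  have hm0 : (m : ℝ≥0∞) ≠ 0 := by exact_mod_cast (by omega : m ≠ 0)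
  have hmd : (m : ℝ≥0∞) ^ d ≠ ⊤ := ENNReal.rpow_ne_top_of_nonneg hd.le (ENNReal.natCast_ne_top m)
  have hmd0 : (m : ℝ≥0∞) ^ d ≠ 0 :=
    (ENNReal.rpow_pos (pos_iff_ne_zero.2 hm0) (ENNReal.natCast_ne_top m)).ne'
  have hlim := tendsto_inv_natCast_pow hm
  have hpiece : ∀ E : Set (SeqSpace m), Metric.ediam E ≤ ρ N → ∀ ω ∈ G, X ω ∈ E →
      P (G ∩ X ⁻¹' E) ≤ (m : ℝ≥0∞) ^ d * Metric.ediam E ^ d := by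
    intro E hE ω hω hωE
    have hle : ∀ n ≥ N, Metric.ediam E ≤ ρ n → P (G ∩ X ⁻¹' E) ≤ ρ n ^ d := by
      intro n hn hEn
      refine (measure_mono ?_).trans (hcyl ω hω n hn)
      rintro ω' ⟨-, hω'⟩
      exact (edist_le_inv_pow_iff hm).1
        ((Metric.edist_le_ediam_of_mem (show X ω' ∈ E from hω') hωE).trans hEn)
    -- A set of diameter 0 lies in cylinders of every length, hence carries no mass. Otherwise, for
    -- the first `n` with `ρ n < ediam E`, the set lies in a cylinder of length `n - 1`, and `ρ (n -
    -- 1) = m ρ n` costs the factor `m^d`.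
    rcases eq_or_ne (Metric.ediam E) 0 with h0 | h0
    · have hlim' : Tendsto (fun n => ρ n ^ d) atTop (𝓝 0) := by
        have := (ENNReal.continuous_rpow_const (y := d)).tendsto 0 |>.comp hlim
        rwa [ENNReal.zero_rpow_of_pos hd] at this
      refine (ge_of_tendsto hlim' ?_).trans (zero_le)
      filter_upwards [eventually_ge_atTop N] with n hn
      exact hle n hn (by rw [h0]; exact zero_le)
    · have hex : ∃ n, ρ n < Metric.ediam E :=
        (hlim.eventually (gt_mem_nhds (pos_iff_ne_zero.2 h0))).exists
      classical
      have hn := Nat.find_spec hex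
      have hmin := fun k => Nat.find_min (m := k) hex
      set n := Nat.find hex
      have hNn : N < n := by
        by_contra! h
        have : ρ N ≤ ρ n := pow_le_pow_right_of_le_one' (ENNReal.inv_le_one.2
          (by exact_mod_cast (by omega : 1 ≤ m))) h
        exact absurd (hn.trans_le hE) this.not_gt
      obtain ⟨k, hk⟩ : ∃ k, n = k + 1 := ⟨n - 1, by omega⟩
      refine (hle k (by omega) (not_lt.1 (hmin k (by omega)))).trans ?_
      rw [← ENNReal.mul_rpow_of_nonneg _ _ hd.le]
      refine ENNReal.rpow_le_rpow ?_ hd.le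
      have : ρ k = m * ρ n := by
        rw [hk, hρ]
        simp only
        rw [pow_succ', ← mul_assoc, ENNReal.mul_inv_cancel hm0 (ENNReal.natCast_ne_top m), one_mul]
      rw [this]
      gcongr
  have hmain : P G / (m : ℝ≥0∞) ^ d ≤ Measure.hausdorffMeasure d S := by
    rw [Measure.hausdorffMeasure_apply]
    refine le_iSup₂_of_le (ρ N) (ENNReal.pow_pos (ENNReal.inv_pos.2 (ENNReal.natCast_ne_top m)) N) ?_
    refine le_iInf₂ fun E hcov => le_iInf fun hdiam => ?_
    rw [ENNReal.div_le_iff_le_mul (Or.inl hmd0) (Or.inl hmd), mul_comm,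
      ← ENNReal.tsum_mul_left]
    calc P G ≤ P (⋃ i, G ∩ X ⁻¹' E i) := measure_mono fun ω hω => by
          obtain ⟨i, hi⟩ := Set.mem_iUnion.1 (hcov (hGS hω))
          exact Set.mem_iUnion.2 ⟨i, hω, hi⟩
      _ ≤ ∑' i, P (G ∩ X ⁻¹' E i) := measure_iUnion_le _
      _ ≤ _ := ENNReal.tsum_le_tsum fun i => by
        rcases (G ∩ X ⁻¹' E i).eq_empty_or_nonempty with h | ⟨ω, hω, hωE⟩
        · simp [h]
        · rw [iSup_pos ⟨X ω, hωE⟩]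
          exact hpiece _ (hdiam i) ω hω hωE
  intro h0
  rw [h0, nonpos_iff_eq_zero, ENNReal.div_eq_zero_iff] at hmain
  exact hmain.elim hG hmd

end Scales

/-! ### The optimal Markov chain and its cylinder masses. -/

section StepLaw

open MeasureTheory

variable {m q : ℕ} {A : Matrix (Fin m) (Fin m) ℝ} {t : Fin m → ℝ}

/-- The initial and transition probabilities of the optimal Markov chain. -/
noncomputable def stepProb (q : ℕ) (A : Matrix (Fin m) (Fin m) ℝ) (t : Fin m → ℝ) :
    Option (Fin m) → Fin m → ℝ
  | none, a => t a / ∑ i, t i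
  | some b, a => A b a * t a / t b ^ q

lemma stepProb_nonneg (hA : A.IsPrimitive) (ht : IsSolutionVector q A t) (o : Option (Fin m))
    (a : Fin m) : 0 ≤ stepProb q A t o a := by
  have htpos : ∀ i, 0 < t i := fun i => zero_lt_one.trans (ht i).2
  cases o with
  | none => exact div_nonneg (htpos a).le (Finset.sum_nonneg fun i _ => (htpos i).le)
  | some b => exact div_nonneg (mul_nonneg (hA.nonneg b a) (htpos a).le) (pow_pos (htpos b) q).le

lemma one_lt_sum_solution (hm : 2 ≤ m) (ht : IsSolutionVector q A t) : 1 < ∑ i, t i :=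
  (ht ⟨0, by omega⟩).2.trans_le (Finset.single_le_sum
    (fun j _ => (zero_lt_one.trans (ht j).2).le) (Finset.mem_univ (⟨0, by omega⟩ : Fin m)))

lemma sum_stepProb (hm : 2 ≤ m) (ht : IsSolutionVector q A t) (o : Option (Fin m)) :
    ∑ a, stepProb q A t o a = 1 := by
  cases o with
  | none =>
    simp only [stepProb, ← Finset.sum_div]
    exact div_self (zero_lt_one.trans (one_lt_sum_solution hm ht)).ne'
  | some b =>
    simp only [stepProb, ← Finset.sum_div, ← (ht b).1]
    exact div_self (pow_pos (zero_lt_one.trans (ht b).2) q).ne'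

/-- The laws of the steps of the optimal Markov chain. -/
noncomputable def stepLaw (hm : 2 ≤ m) (hA : A.IsPrimitive) (ht : IsSolutionVector q A t)
    (o : Option (Fin m)) : PMF (Fin m) :=
  PMF.ofFintype (fun a => ENNReal.ofReal (stepProb q A t o a)) (by
    rw [← ENNReal.ofReal_sum_of_nonneg fun a _ => stepProb_nonneg hA ht o a, sum_stepProb hm ht,
      ENNReal.ofReal_one])

lemma stepLaw_apply (hm : 2 ≤ m) (hA : A.IsPrimitive) (ht : IsSolutionVector q A t)
    (o : Option (Fin m)) (a : Fin m) :
    stepLaw hm hA ht o a = ENNReal.ofReal (stepProb q A t o a) := rfl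

/-- The logarithm of the measure of the cylinder of length `n` around a point of `multShift q A`. -/
noncomputable def logCylinder (q : ℕ) (t : Fin m → ℝ) (n : ℕ) (x : SeqSpace m) : ℝ :=
  letterSum (fun i => Real.log (t i)) x n - q * letterSum (fun i => Real.log (t i)) x (n / q) -
    (n - (n / q : ℕ)) * Real.log (∑ i, t i)

lemma multShift_letter {x : SeqSpace m} (hx : x ∈ multShift q A) {k : ℕ} (hk : 0 < k)
    (hd : q ∣ k) : A (x.letter (k / q)) (x.letter k) = 1 := by
  have hk' : 0 < k / q := Nat.div_pos (Nat.le_of_dvd hk hd) (Nat.pos_of_dvd_of_pos hd hk)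
  rw [x.letter_eq_digit hk, x.letter_eq_digit hk']
  exact hx _ _ (Nat.mul_div_cancel' hd).symm

/-- On `X_A` the matrix factors are 1. Every letter up to `n` contributes its `t` to a numerator,
every letter up to `n / q` its `t^q` to a denominator, and every non-multiple of `q` a factor `1 /
T`. -/
lemma chainMeasure_cylinder (hm : 2 ≤ m) (hq : 2 ≤ q) (hA : A.IsPrimitive)
    (ht : IsSolutionVector q A t) {x : SeqSpace m} (hx : x ∈ multShift q A) (n : ℕ) :
    chainMeasure (stepLaw hm hA ht) {ω | prefixWord n (chainPoint q ω) = prefixWord n x} =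
      ENNReal.ofReal (Real.exp (logCylinder q t n x)) := by
  have htpos : ∀ i, 0 < t i := fun i => zero_lt_one.trans (ht i).2
  have hT := zero_lt_one.trans (one_lt_sum_solution hm ht)
  let F : ℕ → ℝ := fun k =>
    if q ∣ k then Real.log (t (x.letter k)) - q * Real.log (t (x.letter (k / q)))
    else Real.log (t (x.letter k)) - Real.log (∑ i, t i)
  have hF : ∀ k ∈ Finset.Icc 1 n,
      stepLaw hm hA ht (parentLetter q x k) (x.letter k) = ENNReal.ofReal (Real.exp (F k)) := by
    intro k hk
    rw [stepLaw_apply, parentLetter]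
    congr 1
    simp only [F]
    split_ifs with hd
    · rw [stepProb, multShift_letter hx (Finset.mem_Icc.1 hk).1 hd, one_mul, Real.exp_sub,
        Real.exp_nat_mul, Real.exp_log (htpos _), Real.exp_log (htpos _)]
    · rw [stepProb, Real.exp_sub, Real.exp_log (htpos _), Real.exp_log hT]
  rw [chainMeasure_prefixWord hq, Finset.prod_congr rfl hF,
    ← ENNReal.ofReal_prod_of_nonneg fun k _ => (Real.exp_pos _).le, ← Real.exp_sum]
  congr 2
  rw [sum_Icc_eq_nonmultiples_add hq, logCylinder, letterSum, letterSum,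
    sum_Icc_eq_nonmultiples_add hq n, ← card_nonmultiples hq]
  have h1 : ∑ i ∈ nonmultiples q n, F i = ∑ i ∈ nonmultiples q n, Real.log (t (x.letter i)) -
      (nonmultiples q n).card * Real.log (∑ i, t i) := by
    rw [← nsmul_eq_mul, ← Finset.sum_const, ← Finset.sum_sub_distrib]
    exact Finset.sum_congr rfl fun i hi => if_neg (mem_nonmultiples.1 hi).2
  have h2 : ∑ k ∈ Finset.Icc 1 (n / q), F (k * q) =
      ∑ k ∈ Finset.Icc 1 (n / q), Real.log (t (x.letter (k * q))) -
        q * ∑ k ∈ Finset.Icc 1 (n / q), Real.log (t (x.letter k)) := by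
    rw [Finset.mul_sum, ← Finset.sum_sub_distrib]
    refine Finset.sum_congr rfl fun k _ => ?_
    simp only [F, dvd_mul_left, if_true, Nat.mul_div_cancel k (by omega : 0 < q)]
  rw [h1, h2]
  ring

/-- If `S(n)/n → L`, then `q S(n/q)/n → L` too, so the unknown limit cancels. -/
lemma ae_tendsto_logCylinder_div (hm : 2 ≤ m) (hq : 2 ≤ q) (hA : A.IsPrimitive)
    (ht : IsSolutionVector q A t) :
    ∀ᵐ ω ∂chainMeasure (stepLaw hm hA ht),
      Tendsto (fun n : ℕ => logCylinder q t n (chainPoint q ω) / n) atTop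
        (𝓝 (-((1 - 1 / q) * Real.log (∑ i, t i)))) := by
  filter_upwards [ae_exists_tendsto_letterSum_div hq (stepLaw hm hA ht) fun i => Real.log (t i)]
    with ω ⟨L, hL⟩
  have hq0 : (q : ℝ) ≠ 0 := by positivity
  have hdiv := tendsto_natDiv_div (d := q) (by omega)
  have hL' := ((hL.comp (tendsto_natDiv_atTop (d := q) (by omega))).mul hdiv).const_mul (q : ℝ)
  have h := (hL.sub hL').sub ((hdiv.const_sub 1).mul_const (Real.log (∑ i, t i)))
  have hlim : L - q * (L * (1 / q)) - (1 - 1 / q) * Real.log (∑ i, t i) =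
      -((1 - 1 / q) * Real.log (∑ i, t i)) := by
    field_simp
    ring
  rw [hlim] at h
  refine h.congr' ?_
  filter_upwards [eventually_ge_atTop q] with n hn
  have hn0 : (n : ℝ) ≠ 0 := by exact_mod_cast (by omega : n ≠ 0)
  have hnq : ((n / q : ℕ) : ℝ) ≠ 0 := by exact_mod_cast (Nat.div_pos hn (by omega)).ne'
  simp only [Function.comp_apply, logCylinder]
  field_simp

lemma ae_chainPoint_mem_multShift (hm : 2 ≤ m) (hq : 2 ≤ q)
    (hA01 : ∀ i j, A i j = 0 ∨ A i j = 1) (hA : A.IsPrimitive) (ht : IsSolutionVector q A t) :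
    ∀ᵐ ω ∂chainMeasure (stepLaw hm hA ht), chainPoint q ω ∈ multShift q A := by
  filter_upwards [ae_chainMeasure_apply_ne_zero (stepLaw hm hA ht)] with ω hω k l hl
  rw [mul_comm] at hl
  refine (hA01 _ _).resolve_left fun h0 => ?_
  have := hω (chainRoot q l) (chainPos q l) (some ((chainPoint q ω).digit k))
  rw [← chainPoint_digit_mul hq ω hl, stepLaw_apply, stepProb, h0] at this
  simp at this

end StepLaw

/-! ### Upper and lower bounds for the Hausdorff dimension. -/

section HausdorffDimension

open MeasureTheory

variable {m q : ℕ} {A : Matrix (Fin m) (Fin m) ℝ} {t : Fin m → ℝ}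

/-- Otherwise `b` would eventually drop by more than `ε` at each step and become negative. -/
lemma frequently_neg_le_sub {b : ℕ → ℝ} (hb : ∀ k, 0 ≤ b k) {ε : ℝ} (hε : 0 < ε) :
    ∃ᶠ k in atTop, -ε ≤ b (k + 1) - b k := by
  intro h
  obtain ⟨K, hK⟩ := eventually_atTop.1 h
  have hdec : ∀ n : ℕ, b (K + n) ≤ b K - n * ε := by
    intro n
    induction n with
    | zero => simp
    | succ n ih =>
      have := not_le.1 (hK (K + n) (by omega))
      push_cast
      rw [← add_assoc]
      linarith
  obtain ⟨n, hn⟩ := exists_nat_gt (b K / ε)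
  rw [div_lt_iff₀ hε] at hn
  linarith [hdec n, hb (K + n)]

/-- For `n = q^(k+1)` the normalised log-mass is `b (k+1) - b k - (1 - 1/q) log T` with `b k =
S(q^k)/q^k`, which is nonnegative because `t_i > 1`. This holds at every point of the space, not
just almost everywhere. -/
lemma frequently_le_logCylinder (hq : 2 ≤ q) (ht : IsSolutionVector q A t) (x : SeqSpace m)
    {ε : ℝ} (hε : 0 < ε) :
    ∃ᶠ k in atTop, -((q ^ k : ℕ) * ((1 - 1 / q) * Real.log (∑ i, t i) + ε)) ≤
      logCylinder q t (q ^ k) x := by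
  have hq0 : (0 : ℝ) < q := by positivity
  let b : ℕ → ℝ := fun k => letterSum (fun i => Real.log (t i)) x (q ^ k) / (q : ℝ) ^ k
  have hb : ∀ k, 0 ≤ b k := fun k => div_nonneg
    (Finset.sum_nonneg fun i _ => Real.log_nonneg (ht _).2.le) (by positivity)
  have h := frequently_neg_le_sub hb hε
  refine (Filter.tendsto_add_atTop_nat 1).frequently (p := fun k =>
    -((q ^ k : ℕ) * ((1 - 1 / q) * Real.log (∑ i, t i) + ε)) ≤ logCylinder q t (q ^ k) x) ?_
  refine h.mono fun k hk => ?_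
  have hdiv : q ^ (k + 1) / q = q ^ k := by
    rw [pow_succ, Nat.mul_div_cancel _ (by omega)]
  have e : logCylinder q t (q ^ (k + 1)) x =
      (q : ℝ) ^ (k + 1) * (b (k + 1) - b k - (1 - 1 / q) * Real.log (∑ i, t i)) := by
    simp only [logCylinder, hdiv, b]
    push_cast
    field_simp
    ring
  rw [e]
  push_cast
  have := mul_le_mul_of_nonneg_left hk (by positivity : (0 : ℝ) ≤ (q : ℝ) ^ (k + 1))
  linarith

/-- The words of length `n` whose cylinders have measure at least `exp (-n a)`. -/
noncomputable def heavyWords (q : ℕ) (P : Measure (ℕ → ℕ → Option (Fin m) → Fin m)) (a : ℝ)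
    (n : ℕ) : Set (Finset.Icc 1 n → Fin m) :=
  {w | ENNReal.ofReal (Real.exp (-(n * a))) ≤ P {ω | prefixWord n (chainPoint q ω) = w}}

lemma card_heavyWords_mul_le (P : Measure (ℕ → ℕ → Option (Fin m) → Fin m))
    [IsProbabilityMeasure P] (a : ℝ) (n : ℕ) :
    (Nat.card (heavyWords q P a n) : ℝ≥0∞) * ENNReal.ofReal (Real.exp (-(n * a))) ≤ 1 := by
  classical
  have hfin : (heavyWords q P a n).Finite := Set.toFinite _
  calc (Nat.card (heavyWords q P a n) : ℝ≥0∞) * ENNReal.ofReal (Real.exp (-(n * a)))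
      = ∑ w ∈ hfin.toFinset, ENNReal.ofReal (Real.exp (-(n * a))) := by
        rw [Finset.sum_const, nsmul_eq_mul, Nat.card_coe_set_eq, Set.ncard_eq_toFinset_card _ hfin]
    _ ≤ ∑ w ∈ hfin.toFinset, P ((fun ω => prefixWord n (chainPoint q ω)) ⁻¹' {w}) :=
        Finset.sum_le_sum fun w hw => hfin.mem_toFinset.1 hw
    _ = _ := sum_measure_preimage_singleton _ fun w _ =>
        measurable_prefixWord_chainPoint n (measurableSet_singleton w)
    _ ≤ 1 := prob_le_one

/-- Cover by the heavy cylinders of lengths `q^k`, `k ≥ K`. The sum of the diameters to the power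
`d` is bounded by a geometric series independent of `K`. -/
lemma hausdorffMeasure_multShift_ne_top [MeasurableSpace (SeqSpace m)] [BorelSpace (SeqSpace m)]
    (hm : 2 ≤ m) (hq : 2 ≤ q) (hA : A.IsPrimitive) (ht : IsSolutionVector q A t) {d : ℝ}
    (hd : (1 - 1 / q) * Real.log (∑ i, t i) < d * Real.log m) :
    Measure.hausdorffMeasure d (multShift q A) ≠ ⊤ := by
  set σ := (1 - 1 / q) * Real.log (∑ i, t i) with hσ
  -- One `ε` pays for the number of heavy words, the other for the sum over scales.
  obtain ⟨ε, hε, hdε⟩ : ∃ ε > 0, d * Real.log m = σ + ε + ε :=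
    ⟨(d * Real.log m - σ) / 2, by linarith, by ring⟩
  have hd0 : 0 ≤ d := by
    have hσ0 : 0 ≤ σ := by
      refine mul_nonneg ?_ (Real.log_nonneg (one_lt_sum_solution hm ht).le)
      rw [sub_nonneg, div_le_one (by positivity)]
      exact_mod_cast (by omega : 1 ≤ q)
    have hlog : 0 < Real.log m := Real.log_pos (by exact_mod_cast (by omega : 1 < m))
    by_contra! h
    linarith [mul_neg_of_neg_of_pos h hlog]
  set P := chainMeasure (stepLaw hm hA ht)
  let ι : ℕ → Type := fun K => Σ k : ℕ, heavyWords q P (σ + ε) (q ^ (k + K))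
  let E : ∀ K, ι K → Set (SeqSpace m) := fun K i => {x | prefixWord (q ^ (i.1 + K)) x = i.2}
  have hdiam : ∀ K (i : ι K), Metric.ediam (E K i) ≤ ((m : ℝ≥0∞)⁻¹) ^ (q ^ (i.1 + K)) := by
    intro K i
    refine Metric.ediam_le fun x hx y hy => ?_
    exact (edist_le_inv_pow_iff hm).2 (Eq.trans hx (Eq.symm hy))
  have hle1 : (m : ℝ≥0∞)⁻¹ ≤ 1 := ENNReal.inv_le_one.2 (by exact_mod_cast (by omega : 1 ≤ m))
  have hcov : ∀ K, multShift q A ⊆ ⋃ i, E K i := by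
    intro K x hx
    obtain ⟨k, hk, hkx⟩ := frequently_atTop.1 (frequently_le_logCylinder hq ht x hε) K
    obtain ⟨l, rfl⟩ := Nat.exists_eq_add_of_le' hk
    refine Set.mem_iUnion.2 ⟨⟨l, prefixWord _ x, ?_⟩, rfl⟩
    change ENNReal.ofReal _ ≤ P {ω | _}
    rw [chainMeasure_cylinder hm hq hA ht hx]
    exact ENNReal.ofReal_le_ofReal (Real.exp_le_exp.2 hkx)
  have hsum : ∀ K, ∑' i, Metric.ediam (E K i) ^ d ≤ (1 - ENNReal.ofReal (Real.exp (-ε)))⁻¹ := by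
    intro K
    rw [← ENNReal.tsum_geometric, ENNReal.tsum_sigma']
    refine ENNReal.tsum_le_tsum fun k => ?_
    set n := q ^ (k + K) with hn
    calc ∑' w : heavyWords q P (σ + ε) n, Metric.ediam (E K ⟨k, w⟩) ^ d
        ≤ ∑' w : heavyWords q P (σ + ε) n, (((m : ℝ≥0∞)⁻¹) ^ n) ^ d :=
          ENNReal.tsum_le_tsum fun w => ENNReal.rpow_le_rpow (hdiam K ⟨k, w⟩) hd0
      _ = Nat.card (heavyWords q P (σ + ε) n) * (ENNReal.ofReal (Real.exp (-(n * (σ + ε)))) *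
            ENNReal.ofReal (Real.exp (-(n * ε)))) := by
          rw [ENNReal.tsum_const, ENat.card_eq_coe_natCard, ENat.toENNReal_coe,
            inv_natCast_pow_rpow hm, hdε, ← ENNReal.ofReal_mul (Real.exp_pos _).le, ← Real.exp_add]
          ring_nf
      _ ≤ 1 * ENNReal.ofReal (Real.exp (-(n * ε))) := by
          rw [← mul_assoc]
          gcongr
          exact card_heavyWords_mul_le P _ n
      _ ≤ ENNReal.ofReal (Real.exp (-ε)) ^ k := by
          rw [one_mul, ← ENNReal.ofReal_pow (Real.exp_pos _).le, ← Real.exp_nat_mul]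
          refine ENNReal.ofReal_le_ofReal (Real.exp_le_exp.2 ?_)
          have hkn : k ≤ n := by
            have := Nat.lt_pow_self (n := k + K) (by omega : 1 < q)
            omega
          have : (k : ℝ) * ε ≤ n * ε := by gcongr
          linarith
  have hfin : (1 - ENNReal.ofReal (Real.exp (-ε)))⁻¹ ≠ ⊤ := by
    rw [ENNReal.inv_ne_top, ← ENNReal.ofReal_one, ← ENNReal.ofReal_sub _ (Real.exp_pos _).le]
    have hlt : Real.exp (-ε) < 1 := by
      rw [← Real.exp_zero]
      exact Real.exp_lt_exp.2 (by linarith)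
    exact (ENNReal.ofReal_pos.2 (sub_pos.2 hlt)).ne'
  refine ne_top_of_le_ne_top hfin ((Measure.hausdorffMeasure_le_liminf_tsum d (multShift q A)
    (l := atTop) (fun K => ((m : ℝ≥0∞)⁻¹) ^ K) (tendsto_inv_natCast_pow hm) E
    (Eventually.of_forall fun K i => (hdiam K i).trans ?_) (Eventually.of_forall hcov)).trans ?_)
  · refine pow_le_pow_right_of_le_one' hle1 ?_
    have := Nat.lt_pow_self (n := i.1 + K) (by omega : 1 < q)
    omega
  · exact (liminf_le_liminf (Eventually.of_forall hsum)).trans (liminf_const _).le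

lemma hausdorffMeasure_multShift_ne_zero [MeasurableSpace (SeqSpace m)] [BorelSpace (SeqSpace m)]
    (hm : 2 ≤ m) (hq : 2 ≤ q) (hA01 : ∀ i j, A i j = 0 ∨ A i j = 1) (hA : A.IsPrimitive)
    (ht : IsSolutionVector q A t) {d : ℝ} (hd0 : 0 < d)
    (hd : d * Real.log m < (1 - 1 / q) * Real.log (∑ i, t i)) :
    Measure.hausdorffMeasure d (multShift q A) ≠ 0 := by
  set P := chainMeasure (stepLaw hm hA ht) with hP
  -- The almost sure decay holds from a random index on; these sets fix the index, and since their
  -- union has full measure one of them has positive mass.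
  let G : ℕ → Set (ℕ → ℕ → Option (Fin m) → Fin m) := fun N =>
    {ω | chainPoint q ω ∈ multShift q A ∧
      ∀ n ≥ N, logCylinder q t n (chainPoint q ω) ≤ -(n * (d * Real.log m))}
  have hae : ∀ᵐ ω ∂P, ω ∈ ⋃ N, G N := by
    filter_upwards [ae_tendsto_logCylinder_div hm hq hA ht,
      ae_chainPoint_mem_multShift hm hq hA01 hA ht] with ω hω hmem
    have hev := hω.eventually (gt_mem_nhds (neg_lt_neg hd))
    obtain ⟨N, hN⟩ := eventually_atTop.1 (hev.and (eventually_gt_atTop 0))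
    refine Set.mem_iUnion.2 ⟨N, hmem, fun n hn => ?_⟩
    obtain ⟨h1, h2⟩ := hN n hn
    have h2' : (0 : ℝ) < n := by exact_mod_cast h2
    rw [div_lt_iff₀ h2'] at h1
    linarith
  obtain ⟨N, hN⟩ : ∃ N, P (G N) ≠ 0 := by
    by_contra! h
    have h0 : P (⋃ N, G N) = 0 := measure_iUnion_null h
    obtain ⟨ω, hω, hω'⟩ := (hae.and (measure_eq_zero_iff_ae_notMem.1 h0)).exists
    exact hω' hω
  refine hausdorffMeasure_ne_zero_of_measure_cylinder_le hm (X := chainPoint q) hN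
    (fun ω hω => hω.1) hd0 (N := N) fun ω hω n hn => ?_
  rw [chainMeasure_cylinder hm hq hA ht hω.1, inv_natCast_pow_rpow hm]
  exact ENNReal.ofReal_le_ofReal (Real.exp_le_exp.2 (hω.2 n hn))

theorem dimH_multShift (hm : 2 ≤ m) (hq : 2 ≤ q) (hA01 : ∀ i j, A i j = 0 ∨ A i j = 1)
    (hA : A.IsPrimitive) (ht : IsSolutionVector q A t) :
    dimH (multShift q A) =
      ENNReal.ofReal ((1 - 1 / q) * Real.log (∑ i, t i) / Real.log m) := by
  borelize (SeqSpace m)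
  have hlog : 0 < Real.log m := Real.log_pos (by exact_mod_cast (by omega : 1 < m))
  apply le_antisymm
  · by_contra! h
    obtain ⟨d, hd1, hd2⟩ := ENNReal.lt_iff_exists_nnreal_btwn.1 h
    refine (dimH_le_of_hausdorffMeasure_ne_top
      (hausdorffMeasure_multShift_ne_top hm hq hA ht ?_)).not_gt hd2
    by_contra! hle
    refine hd1.not_ge ?_
    rw [← ENNReal.ofReal_coe_nnreal]
    exact ENNReal.ofReal_le_ofReal ((le_div_iff₀ hlog).2 hle)
  · by_contra! h
    obtain ⟨d, hd1, hd2⟩ := ENNReal.lt_iff_exists_nnreal_btwn.1 h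
    have hd0 : 0 < d := by
      have := (zero_le).trans_lt hd1
      exact_mod_cast this
    refine (le_dimH_of_hausdorffMeasure_ne_zero (d := d)
      (hausdorffMeasure_multShift_ne_zero hm hq hA01 hA ht (by exact_mod_cast hd0) ?_)).not_gt hd1
    have := (ENNReal.lt_ofReal_iff_toReal_lt ENNReal.coe_ne_top).1 hd2
    rwa [ENNReal.coe_toReal, lt_div_iff₀ hlog] at this

end HausdorffDimension

/-! ### The theorem, assembled. -/

theorem theorem1p2 (m q : ℕ) (hm : 2 ≤ m) (hq : 2 ≤ q)
    (A : Matrix (Fin m) (Fin m) ℝ) (hA01 : ∀ i j, A i j = 0 ∨ A i j = 1)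
    (hA : A.IsPrimitive) :
    -- existence and uniqueness of the vector `t`, and the Hausdorff dimension
    (∃! t : Fin m → ℝ, IsSolutionVector q A t) ∧
    (∀ t : Fin m → ℝ, IsSolutionVector q A t →
      (dimH (multShift q A) : EReal) =
        ((((q : ℝ) - 1) / q * Real.logb m (∑ i, t i) : ℝ) : EReal)) ∧
    -- the Minkowski dimension exists; the series index is `k - 1`
    Summable (fun k : ℕ => Real.logb m (((A ^ k) *ᵥ 1) ⬝ᵥ 1) / (q : ℝ) ^ (k + 2)) ∧
    HasMinkowskiDim (multShift q A)
      ((((q : ℝ) - 1) ^ 2 *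
        ∑' k : ℕ, Real.logb m (((A ^ k) *ᵥ 1) ⬝ᵥ 1) / (q : ℝ) ^ (k + 2) : ℝ) : EReal) ∧
    -- the two dimensions agree iff the all-ones vector is an eigenvector of `A`,
    -- that is, iff all row sums of `A` are equal
    (HasMinkowskiDim (multShift q A) (dimH (multShift q A) : EReal) ↔
      ∃ c : ℝ, Module.End.HasEigenvector (Matrix.toLin' A) c (1 : Fin m → ℝ)) ∧
    ((∃ c : ℝ, Module.End.HasEigenvector (Matrix.toLin' A) c (1 : Fin m → ℝ)) ↔
      ∀ i i' : Fin m, ∑ j, A i j = ∑ j, A i' j) := by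
  have hq0 : (0 : ℝ) < q := by positivity
  have hq1 : (1 : ℝ) < q := by exact_mod_cast (by omega : 1 < q)
  have hlog : 0 < Real.log m := Real.log_pos (by exact_mod_cast (by omega : 1 < m))
  have hnt : Nonempty (Fin m) := ⟨⟨0, by omega⟩⟩
  have hdimH : ∀ t : Fin m → ℝ, IsSolutionVector q A t → (dimH (multShift q A) : EReal) =
      (((1 - 1 / q) * Real.log (∑ i, t i) / Real.log m : ℝ) : EReal) := by
    intro t ht
    have h0 : 0 ≤ (1 - 1 / (q : ℝ)) * Real.log (∑ i, t i) / Real.log m := by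
      refine div_nonneg (mul_nonneg ?_ (Real.log_nonneg (one_lt_sum_solution hm ht).le)) hlog.le
      rw [sub_nonneg, div_le_one hq0]
      exact hq1.le
    rw [dimH_multShift hm hq hA01 hA ht, EReal.coe_ennreal_ofReal, max_eq_left h0]
  -- The extra `q²` in the denominator turns `(q-1)²` into `(1 - 1/q)²`.
  have hterm : ∀ k : ℕ, Real.logb m (((A ^ k) *ᵥ 1) ⬝ᵥ 1) / (q : ℝ) ^ (k + 2) =
      (Real.log (wordCount A k) / (q : ℝ) ^ k) / (Real.log m * (q : ℝ) ^ 2) := by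
    intro k
    rw [Real.logb, wordCount, pow_add]
    field_simp
  have hmink := hasMinkowskiDim_multShift hm hq hA01 hA
  have hrow : (∃ c : ℝ, Module.End.HasEigenvector (Matrix.toLin' A) c (1 : Fin m → ℝ)) ↔
      ∀ i i' : Fin m, ∑ j, A i j = ∑ j, A i' j := by
    have hone : A *ᵥ 1 = fun i => ∑ j, A i j := by
      funext i
      simp [Matrix.mulVec, dotProduct]
    simp only [Module.End.hasEigenvector_iff, Module.End.mem_eigenspace_iff, Matrix.toLin'_apply,
      hone]
    constructor
    · rintro ⟨c, hc, -⟩ i i'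
      exact (congrFun hc i).trans (congrFun hc i').symm
    · intro h
      refine ⟨∑ j, A hnt.some j, funext fun i => ?_, one_ne_zero⟩
      simpa using h i _
  obtain ⟨t, ht, htuniq⟩ := existsUnique_isSolutionVector hm hq hA01 hA
  refine ⟨⟨t, ht, htuniq⟩, fun t ht => ?_, ?_, ?_, ?_, hrow⟩
  · rw [hdimH t ht, Real.logb]
    congr 1
    field_simp
  · exact ((summable_log_wordCount hm hq hA01 hA).div_const _).congr fun k => (hterm k).symm
  · convert hmink using 2
    rw [tsum_congr hterm, tsum_div_const]
    field_simp
  · have hiff : HasMinkowskiDim (multShift q A) (dimH (multShift q A) : EReal) ↔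
        Real.log (∑ i, t i) =
          (1 - 1 / q) * ∑' k : ℕ, Real.log (wordCount A k) / (q : ℝ) ^ k := by
      have h1 : (1 : ℝ) - 1 / q ≠ 0 := by
        rw [sub_ne_zero, ne_comm]
        exact ((div_lt_one hq0).2 hq1).ne
      have hreal : (1 - 1 / (q : ℝ)) * Real.log (∑ i, t i) / Real.log m =
          (1 - 1 / q) ^ 2 * (∑' k : ℕ, Real.log (wordCount A k) / (q : ℝ) ^ k) / Real.log m ↔
          Real.log (∑ i, t i) =
            (1 - 1 / q) * ∑' k : ℕ, Real.log (wordCount A k) / (q : ℝ) ^ k := by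
        rw [div_left_inj' hlog.ne', sq, mul_assoc, mul_right_inj' h1]
      rw [← hreal, hdimH t ht]
      constructor
      · intro h
        exact EReal.coe_injective (h.1.symm.trans hmink.1)
      · intro h
        rw [h]
        exact hmink
    rw [hiff]
    constructor
    · intro h
      have hconst := eq_of_log_sum_eq_tsum hm hq hA01 hA ht h
      rw [hrow]
      intro i i'
      -- For constant `t` the equation reads `t^q = (row sum) · t`, so the row sums coincide.
      have hsum : ∀ i, t i ^ q = (∑ j, A i j) * t hnt.some := fun i => by
        rw [(ht i).1, Finset.sum_mul]
        exact Finset.sum_congr rfl fun j _ => by rw [hconst j]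
      refine mul_right_cancel₀ (zero_lt_one.trans (ht hnt.some).2).ne' ?_
      rw [← hsum, ← hsum, hconst i i']
    · rintro ⟨c, hc⟩
      refine log_sum_eq_tsum_of_mulVec_one hm hq hA ht (c := c) ?_
      simpa using hc.apply_eq_smul
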